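/- **Notation.** Let $n\ge 1$ and $[n]=\{1,\dots,n\}$. "Measure" means finite signed Borel measure. For a Borel set $A\subset\mathbb R^n$, $\mathcal M(A)$ denotes the measures on $\mathbb R^n$ concentrated on $A$, $\mathcal M_{\rm sym}(A)$ those $\mu\in\mathcal M(A)$ with $\mu(-C)=\mu(C)$ for all Borel $C$, and $M_{\rm sym}(\mu)(C)=\frac12(\mu(C)+\mu(-C))$. Let $xy$ be the componentwise product on $\mathbb R^n$. The multiplicative convolution of two measures is $$(\mu\circledast\nu)(C)=\int_{\mathbb R^n}\mu(dx)\int_{\mathbb R^n}\nu(dy)\,\mathbf 1_C(xy).$$ For $\mu$ with $\int\|x\|_2\,|\mu|(dx)<\infty$, the radial projection $P_S(\mu)\in\mathcal M(S^{n-1})$ is $$P_S(\mu)(C)=\int_{\mathbb R^n\setminus\{0\}}\|x\|_2\,\mathbf 1_C\big(x/\|x\|_2\big)\,\mu(dx),$$ and $\mu\circledast_S\nu=P_S(\mu\circledast\nu)$ for such $\mu,\nu$. For $E\subset[n]$ let $A_E=\{x\in\mathbb R^n: x_i\ne0\Leftrightarrow i\in E\}$, $B_E=A_E\cap S^{n-1}$,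 and $R_E(\mu)=\mu_E=\mu(\,\cdot\,\cap A_E)$. Let $P_E$ be the orthogonal projection of $\mathbb R^n$ onto the span of $\{e_i:i\in E\}$, $P_E(\mu)=\mu\circ P_E^{-1}$, $P^S_E(\mu)=P_S(P_E(\mu))$ and $P^S_i=P^S_{\{i\}}$. The measure $\mu$ is *of order* $E$ if $|\mu|(A_E)>0$ and $|\mu|(A_F)=0$ for all $F\ne E$. For $J\subset E\subset[n]$ put $$\delta_{E,J}=2^{-|E|}\sum_{s}\Big(\prod_{j\in J}s_j\Big)\delta_s,$$ where $s$ runs over the vectors with $s_j\in\{-1,1\}$ for $j\in E$ and $s_j=0$ for $j\notin E$ (an empty product being $1$), and $\delta_J=\delta_{[n],J}$. A measure $\nu\in\mathcal M(S^{n-1})$ is *spherically universal on* $\mathcal A\subset\mathcal M(S^{n-1})$ if, for every $\mu\in\mathcal A$, $\nu\circledast_S\mu=0$ implies $\mu=0$. **Theorem (symmetric measures).** Let $\nu\in\mathcal M(S^{n-1})$. 1. $\nu$ is spherically universal on $\mathcal M_{\rm sym}(B_{[n]})$ if and only if $\delta_J\circledast_S\nu_{[n]}\neq0$ for all $J\subset[n]$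 with $|J|$ even. 2. $\nu$ is spherically universal on $\mathcal M_{\rm sym}(S^{n-1})$ if and only if $\delta_J\circledast_S R_EP^S_E(\nu)\neq0$ for all $J\subset E\subset[n]$ with $E\neq\varnothing$ and $|J|$ even. 3. If $\nu$ is of order $[n]$, then $\nu$ is spherically universal on $\mathcal M_{\rm sym}(S^{n-1})$ if and only if both $\delta_{J,J}\circledast_S\nu\neq0$ for all nonempty $J\subset[n]$ with $|J|$ even, and $M_{\rm sym}P^S_i(\nu)\neq0$ for all $i\in[n]$. -/

import Mathlib

open MeasureTheory

noncomputable section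

namespace SphConv

/-- Euclidean space of dimension `n`, with coordinates indexed by `Fin n`. -/
abbrev Euc (n : ℕ) : Type := EuclideanSpace ℝ (Fin n)

/-- Finite signed Borel measures on Euclidean space. A measure on a Borel set `A` is identified
with a measure on the whole space that is concentrated on `A`. -/
abbrev SMeas (n : ℕ) : Type := SignedMeasure (Euc n)

variable {n : ℕ}

/-! ### Maps and sets in Euclidean space -/

/-- The componentwise (Hadamard) product. -/
def hadamard (x y : Euc n) : Euc n := WithLp.toLp 2 fun i => x i * y i

/-- The orthogonal projection `P_E` on the coordinate subspace spanned by `e_i`, `i ∈ E`. -/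
def coordProj (E : Finset (Fin n)) (x : Euc n) : Euc n :=
  WithLp.toLp 2 fun i => if i ∈ E then x i else 0

/-- The multiple reflection `T_E`, which changes the sign of the coordinates in `E`. -/
def reflect (E : Finset (Fin n)) (x : Euc n) : Euc n :=
  WithLp.toLp 2 fun i => if i ∈ E then -x i else x i

/-- The map `x ↦ x / ‖x‖` onto the unit sphere (the value `0` at `x = 0` is immaterial below). -/
def radial (x : Euc n) : Euc n := ‖x‖⁻¹ • x

/-- The unit sphere `S^{n-1}`. -/
def unitSphere (n : ℕ) : Set (Euc n) := Metric.sphere 0 1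

/-- The set `A_E` of points whose non-zero coordinates are exactly those in `E`. -/
def stratum (E : Finset (Fin n)) : Set (Euc n) := {x | ∀ i, x i ≠ 0 ↔ i ∈ E}

/-- The set `B_E = A_E ∩ S^{n-1}`. -/
def sphStratum (E : Finset (Fin n)) : Set (Euc n) := stratum E ∩ unitSphere n

lemma measurable_hadamard : Measurable fun p : Euc n × Euc n => hadamard p.1 p.2 := by
  unfold hadamard; fun_prop

lemma measurable_coordProj (E : Finset (Fin n)) : Measurable (coordProj E) := by
  unfold coordProj
  refine (WithLp.measurable_toLp 2 _).comp (measurable_pi_lambda _ fun i => ?_)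
  by_cases h : i ∈ E <;> simp only [h, if_true, if_false] <;> fun_prop

lemma measurable_reflect (E : Finset (Fin n)) : Measurable (reflect E) := by
  unfold reflect
  refine (WithLp.measurable_toLp 2 _).comp (measurable_pi_lambda _ fun i => ?_)
  by_cases h : i ∈ E <;> simp only [h, if_true, if_false] <;> fun_prop

lemma measurable_radial : Measurable (radial (n := n)) := by
  unfold radial; fun_prop

lemma measurableSet_stratum (E : Finset (Fin n)) : MeasurableSet (stratum E) := by
  have h : stratum E = ⋂ i, {x : Euc n | x i ≠ 0 ↔ i ∈ E} := by
    ext x; simp [stratum]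
  rw [h]
  refine MeasurableSet.iInter fun i => ?_
  have h0 : MeasurableSet {x : Euc n | x i = 0} :=
    measurableSet_eq_fun (by fun_prop) measurable_const
  by_cases hi : i ∈ E
  · simp only [hi, iff_true]
    exact h0.compl
  · simpa only [hi, iff_false, not_not] using h0

instance isFiniteMeasure_variation (μ : SMeas n) : IsFiniteMeasure μ.variation := by
  rw [← SignedMeasure.totalVariation_eq_variation, SignedMeasure.totalVariation]
  infer_instance

/-! ### Operations on signed measures -/

/-- `μ` is concentrated on `A`: it vanishes on every Borel set that is disjoint from `A`. -/
def ConcentratedOn (μ : SMeas n) (A : Set (Euc n)) : Prop :=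
  ∀ B, MeasurableSet B → B ⊆ Aᶜ → μ B = 0

/-- The multiplicative convolution: the image of the product measure under the componentwise
product. -/
def mulConv (μ ν : SMeas n) : SMeas n :=
  (VectorMeasure.prod μ ν (ContinuousLinearMap.lsmul ℝ ℝ)).map fun p => hadamard p.1 p.2

/-- The multiplicative convolution as an iterated integral. -/
lemma mulConv_apply (μ ν : SMeas n) {A : Set (Euc n)} (hA : MeasurableSet A) :
    mulConv μ ν A =
      ∫ᵛ x, (∫ᵛ y, A.indicator (fun _ => (1 : ℝ)) (hadamard x y) ∂•ν) ∂•μ := by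
  have hsymm : (ContinuousLinearMap.lsmul ℝ ℝ : ℝ →L[ℝ] ℝ →L[ℝ] ℝ).flip =
      ContinuousLinearMap.lsmul ℝ ℝ := by
    ext; simp
  rw [mulConv, VectorMeasure.map_apply _ measurable_hadamard hA,
    VectorMeasure.prod_apply_eq_integral (measurable_hadamard hA), hsymm]
  congr 1
  funext x
  have hx : Measurable (hadamard x) := measurable_hadamard.comp measurable_prodMk_left
  have h1 : (fun y => A.indicator (fun _ => (1 : ℝ)) (hadamard x y)) =
      (hadamard x ⁻¹' A).indicator (fun _ => (1 : ℝ)) := by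
    rfl
  rw [h1, VectorMeasure.integral_indicator_const _ (hx hA)]
  simp only [ContinuousLinearMap.lsmul_apply, one_smul]
  rfl

/-- The radial projection `P_S`: the image under `x ↦ x / ‖x‖` of the measure with density `‖x‖`
with respect to `μ`. It is meant for measures `μ` with `∫ ‖x‖ |μ|(dx) < ∞`. -/
def radialProj (μ : SMeas n) : SMeas n :=
  (μ.withDensity (fun x => ‖x‖) (ContinuousLinearMap.lsmul ℝ ℝ)).map radial

lemma radialProj_apply (μ : SMeas n) (hμ : VectorMeasure.Integrable μ fun x => ‖x‖)
    {B : Set (Euc n)} (hB : MeasurableSet B) :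
    radialProj μ B = ∫ᵛ x in radial ⁻¹' B, ‖x‖ ∂•μ := by
  rw [radialProj, VectorMeasure.map_apply _ measurable_radial hB,
    VectorMeasure.withDensity_apply hμ]

/-- The spherical product `P_S (μ ⊛ ν)`. -/
def sphConv (μ ν : SMeas n) : SMeas n := radialProj (mulConv μ ν)

/-- The component `R_E μ = μ_E`, which is `μ` restricted to `A_E`. -/
def component (E : Finset (Fin n)) (μ : SMeas n) : SMeas n := μ.restrict (stratum E)

/-- The spherical projection `P^S_E = P_S ∘ P_E`, where `P_E μ` is the image of `μ` under `P_E`. -/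
def sphProj (E : Finset (Fin n)) (μ : SMeas n) : SMeas n := radialProj (μ.map (coordProj E))

/-- The image of `μ` under the multiple reflection `T_E`. -/
def reflectMeas (E : Finset (Fin n)) (μ : SMeas n) : SMeas n := μ.map (reflect E)

/-- The symmetrisation `M_sym μ = (μ + T_[n] μ) / 2`. -/
def symmetrise (μ : SMeas n) : SMeas n := (1 / 2 : ℝ) • (μ + reflectMeas Finset.univ μ)

/-- `M_sym(A)`: the origin-symmetric signed measures concentrated on `A`. -/
def symMeas (A : Set (Euc n)) : Set (SMeas n) :=
  {μ | ConcentratedOn μ A ∧ reflectMeas Finset.univ μ = μ}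

/-- `μ` is of order `E`: `|μ|(A_E) > 0` and `|μ|(A_F) = 0` for every `F ≠ E`. -/
def OfOrder (μ : SMeas n) (E : Finset (Fin n)) : Prop :=
  0 < μ.totalVariation (stratum E) ∧ ∀ F, F ≠ E → μ.totalVariation (stratum F) = 0

/-- The set of vectors with coordinates `±1` in `E` and `0` outside of `E`. -/
def signVectors (E : Finset (Fin n)) : Finset (Fin n → ℝ) :=
  Fintype.piFinset fun i => if i ∈ E then {-1, 1} else {0}

/-- The discrete signed measure
`δ_{E,J} = 2^{-|E|} ∑_s (∏_{j ∈ J} sign s_j) δ_s`, with `s` ranging over `signVectors E`. -/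
def signDelta (E J : Finset (Fin n)) : SMeas n :=
  ((2 : ℝ) ^ E.card)⁻¹ • ∑ s ∈ signVectors E,
    (∏ j ∈ J, Real.sign (s j)) • VectorMeasure.dirac (WithLp.toLp 2 s) (1 : ℝ)

/-- `ν` is spherically universal on `𝒜`: for `μ ∈ 𝒜`, the spherical product of `ν` and `μ`
vanishes only if `μ = 0`. -/
def SphUniversal (ν : SMeas n) (𝒜 : Set (SMeas n)) : Prop :=
  ∀ μ ∈ 𝒜, sphConv ν μ = 0 → μ = 0

end SphConv

end

open MeasureTheory

noncomputable section

namespace SphConv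

variable {n : ℕ}

/-! For `J ⊆ E` and complex exponents `a k`, `k ∈ E`, with positive real parts and sum one, the
monomial `∏ |x_k| ^ a k`, twisted by the signs of the coordinates in `J`, is multiplicative for the
componentwise product and homogeneous of degree one. Its integral, the Mellin transform with index
`(E, J)`, therefore turns the multiplicative convolution into a product and is unchanged by the
radial projection (`mellin_sphConv`).

Two facts make this a criterion. The transform is holomorphic along complex lines of exponents, so
if a product of two transforms vanishes identically, so does one factor (`mellinVanishes_or`). And a
measure on the sphere is zero once all its transforms vanish (`eq_zero_of_mellinVanishes`): on a
stratum the transforms give a characteristic function in logarithmic coordinates, and the strata are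
separated by induction. Hence `sphConv μ ν = 0` if and only if, for each `(E, J)`, the transform of
`μ` or that of `ν` vanishes (`sphConv_eq_zero_iff`).

Symmetry forces the transforms with `|J|` odd to vanish. For `|J|` even, `testMeasure E J` is
symmetric, and `(E, J)` is the only index at which its transform does not vanish. So universality on
symmetric measures of the sphere means that no transform of `ν` with `E` nonempty and `|J|` even
vanishes.

Letting exponents tend to zero shows that, for measures without zero coordinates in `E`, vanishing
at `(E, J)` passes to `(F, J)` whenever `J ⊆ F ⊆ E` (`MellinVanishes.of_subset`). This reduces the
first claim to `E = [n]` and the third to the indices `(J, J)` and `({i}, ∅)`. Finally `signDelta E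
J` has non-zero transform exactly at `(F, J)` with `J ⊆ F ⊆ E`, so spherical products with it test
the corresponding transforms of the other factor. -/

/-! ### Homogeneous monomials -/

/-- The multiplicative character `t ↦ |t| ^ a` of the real line, twisted by the sign if `j`. -/
def signPow (j : Prop) [Decidable j] (a : ℂ) (t : ℝ) : ℂ :=
  (if j then (Real.sign t : ℂ) else 1) * ((|t| : ℝ) : ℂ) ^ a

/-- The monomial `∏_{k ∈ E} |x_k| ^ {a_k}` twisted by the signs of the coordinates in `J`. -/
def monom (E J : Finset (Fin n)) (a : Fin n → ℂ) (x : Euc n) : ℂ :=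
  ∏ k ∈ E, signPow (k ∈ J) (a k) (x k)

/-- Exponents with positive real parts on `E` which add up to one. -/
structure Admissible (E : Finset (Fin n)) (a : Fin n → ℂ) : Prop where
  re_pos : ∀ k ∈ E, 0 < (a k).re
  sum_eq : ∑ k ∈ E, a k = 1

lemma real_sign_mul (s t : ℝ) : Real.sign (s * t) = Real.sign s * Real.sign t := by
  rcases lt_trichotomy s 0 with hs | hs | hs <;> rcases lt_trichotomy t 0 with ht | ht | ht <;>
    simp [hs, ht, Real.sign_of_neg, Real.sign_of_pos, mul_pos_of_neg_of_neg, mul_neg_of_neg_of_pos,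
      mul_neg_of_pos_of_neg]

lemma measurable_real_sign : Measurable Real.sign := by
  unfold Real.sign
  exact Measurable.ite measurableSet_Iio measurable_const
    (Measurable.ite measurableSet_Ioi measurable_const measurable_const)

lemma abs_real_sign_le (t : ℝ) : |Real.sign t| ≤ 1 := by
  rcases Real.sign_apply_eq t with h | h | h <;> simp [h]

lemma signPow_mul (j : Prop) [Decidable j] (a : ℂ) (s t : ℝ) :
    signPow j a (s * t) = signPow j a s * signPow j a t := by
  unfold signPow
  rw [abs_mul, Complex.ofReal_mul, Complex.mul_cpow_ofReal_nonneg (abs_nonneg s) (abs_nonneg t),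
    real_sign_mul]
  split_ifs <;> push_cast <;> ring

lemma signPow_zero (j : Prop) [Decidable j] {a : ℂ} (ha : a ≠ 0) : signPow j a 0 = 0 := by
  simp [signPow, ha]

lemma signPow_of_pos (j : Prop) [Decidable j] (a : ℂ) {t : ℝ} (ht : 0 < t) :
    signPow j a t = (t : ℂ) ^ a := by
  simp [signPow, Real.sign_of_pos ht, abs_of_pos ht]

lemma signPow_neg (j : Prop) [Decidable j] (a : ℂ) (t : ℝ) :
    signPow j a (-t) = (if j then -1 else 1) * signPow j a t := by
  unfold signPow
  rw [abs_neg, Real.sign_neg]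
  split_ifs <;> simp

lemma measurable_signPow (j : Prop) [Decidable j] (a : ℂ) : Measurable (signPow j a) := by
  unfold signPow
  refine Measurable.mul ?_ ((Complex.measurable_ofReal.comp measurable_abs).pow_const a)
  split_ifs
  · exact Complex.measurable_ofReal.comp measurable_real_sign
  · exact measurable_const

lemma norm_signPow_le (j : Prop) [Decidable j] {a : ℂ} (ha : 0 < a.re) {t r : ℝ} (h : |t| ≤ r) :
    ‖signPow j a t‖ ≤ r ^ a.re := by
  rcases eq_or_ne t 0 with rfl | ht
  · rw [signPow_zero j (by rintro rfl; simp at ha), norm_zero]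
    exact Real.rpow_nonneg ((abs_nonneg _).trans h) _
  · unfold signPow
    rw [norm_mul, Complex.norm_cpow_eq_rpow_re_of_pos (abs_pos.2 ht)]
    calc _ ≤ 1 * |t| ^ a.re := by
          gcongr
          split_ifs
          · rw [Complex.norm_real]; exact abs_real_sign_le t
          · simp
      _ ≤ r ^ a.re := by rw [one_mul]; gcongr

lemma Admissible.ne_zero {E : Finset (Fin n)} {a : Fin n → ℂ} (ha : Admissible E a) {k : Fin n}
    (hk : k ∈ E) : a k ≠ 0 := fun h => by simpa [h] using ha.re_pos k hk

lemma Admissible.sum_re {E : Finset (Fin n)} {a : Fin n → ℂ} (ha : Admissible E a) :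
    ∑ k ∈ E, (a k).re = 1 := by
  rw [← Complex.re_sum, ha.sum_eq, Complex.one_re]

lemma Admissible.nonempty {E : Finset (Fin n)} {a : Fin n → ℂ} (ha : Admissible E a) :
    E.Nonempty := by
  rw [Finset.nonempty_iff_ne_empty]
  rintro rfl
  simpa using ha.sum_eq

lemma admissible_const {E : Finset (Fin n)} (hE : E.Nonempty) :
    Admissible E fun _ => ((E.card : ℝ)⁻¹ : ℝ) := by
  have h : (0 : ℝ) < E.card := by exact_mod_cast hE.card_pos
  refine ⟨fun k _ => ?_, ?_⟩
  · rw [Complex.ofReal_re]; positivity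
  · rw [Finset.sum_const, nsmul_eq_mul, Complex.ofReal_inv, Complex.ofReal_natCast,
      mul_inv_cancel₀ (by exact_mod_cast h.ne')]

lemma monom_hadamard (E J : Finset (Fin n)) (a : Fin n → ℂ) (x y : Euc n) :
    monom E J a (hadamard x y) = monom E J a x * monom E J a y := by
  simp only [monom, hadamard, signPow_mul, Finset.prod_mul_distrib]

lemma measurable_monom (E J : Finset (Fin n)) (a : Fin n → ℂ) : Measurable (monom E J a) := by
  unfold monom
  exact Finset.measurable_fun_prod _ fun k _ => (measurable_signPow _ _).comp (by fun_prop)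

/-- Since `|x_k| ≤ ‖x‖` and the real parts add up to one. The bound does not depend on `a`, so `‖x‖`
dominates all monomials at once. -/
lemma norm_monom_le {E : Finset (Fin n)} (J : Finset (Fin n)) {a : Fin n → ℂ}
    (ha : Admissible E a) (x : Euc n) : ‖monom E J a x‖ ≤ ‖x‖ := by
  unfold monom
  rw [norm_prod]
  calc _ ≤ ∏ k ∈ E, ‖x‖ ^ (a k).re := by
        refine Finset.prod_le_prod (fun _ _ => norm_nonneg _) fun k hk => ?_
        exact norm_signPow_le _ (ha.re_pos k hk) (by simpa using PiLp.norm_apply_le x k)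
    _ = ‖x‖ := by
        rw [← Real.rpow_sum_of_nonneg (norm_nonneg x) fun k hk => (ha.re_pos k hk).le, ha.sum_re,
          Real.rpow_one]

lemma monom_zero {E : Finset (Fin n)} (J : Finset (Fin n)) {a : Fin n → ℂ}
    (ha : Admissible E a) : monom E J a 0 = 0 := by
  simpa using norm_monom_le J ha 0

lemma monom_smul {E : Finset (Fin n)} (J : Finset (Fin n)) {a : Fin n → ℂ}
    (ha : Admissible E a) {c : ℝ} (hc : 0 < c) (x : Euc n) :
    monom E J a (c • x) = c * monom E J a x := by
  -- The exponents sum to one: this is homogeneity of degree one.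
  have h : (c : ℂ) = ∏ k ∈ E, (c : ℂ) ^ a k := by
    have hc' : (c : ℂ) ≠ 0 := by exact_mod_cast hc.ne'
    simp_rw [Complex.cpow_def_of_ne_zero hc', ← Complex.exp_sum, ← Finset.mul_sum, ha.sum_eq,
      mul_one, Complex.exp_log hc']
  rw [h]
  simp only [monom, PiLp.smul_apply, smul_eq_mul, signPow_mul, Finset.prod_mul_distrib,
    signPow_of_pos _ _ hc]

/-- Homogeneity absorbs the density `‖x‖` of the radial projection. The value of `radial` at the
origin is harmless because both sides vanish there. -/
lemma norm_mul_monom_radial {E : Finset (Fin n)} (J : Finset (Fin n)) {a : Fin n → ℂ}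
    (ha : Admissible E a) (x : Euc n) : (‖x‖ : ℂ) * monom E J a (radial x) = monom E J a x := by
  rcases eq_or_ne x 0 with rfl | hx
  · simp [monom_zero J ha]
  · have h : 0 < ‖x‖ := norm_pos_iff.2 hx
    rw [radial, monom_smul J ha (inv_pos.2 h), Complex.ofReal_inv, mul_inv_cancel_left₀]
    exact_mod_cast h.ne'

/-- Admissible exponents are non-zero, so `0 ^ a k = 0`. Thus the monomials of `E` see only strata
of index sets containing `E`. -/
lemma monom_eq_zero {E : Finset (Fin n)} (J : Finset (Fin n)) {a : Fin n → ℂ}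
    (ha : Admissible E a) {x : Euc n} {k : Fin n} (hk : k ∈ E) (hx : x k = 0) :
    monom E J a x = 0 :=
  Finset.prod_eq_zero hk (by rw [hx, signPow_zero _ (ha.ne_zero hk)])

lemma monom_coordProj {E F : Finset (Fin n)} (J : Finset (Fin n)) (a : Fin n → ℂ) (h : E ⊆ F)
    (x : Euc n) : monom E J a (coordProj F x) = monom E J a x := by
  unfold monom coordProj
  refine Finset.prod_congr rfl fun k hk => ?_
  simp [h hk]

lemma monom_reflect {E J : Finset (Fin n)} (hJ : J ⊆ E) (a : Fin n → ℂ) (x : Euc n) :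
    monom E J a (reflect Finset.univ x) = (-1) ^ J.card * monom E J a x := by
  unfold monom reflect
  simp only [Finset.mem_univ, if_true, signPow_neg, Finset.prod_mul_distrib, Finset.prod_ite,
    Finset.prod_const, one_pow, mul_one, Finset.filter_mem_eq_inter, Finset.inter_eq_right.2 hJ]

/-! ### Mellin transforms of signed measures -/

/-- The signed measure has bounded support. -/
def BoundedSupp (μ : SMeas n) : Prop := ∃ R : ℝ, ∀ᵐ x ∂μ.variation, ‖x‖ ≤ R

/-- The Mellin transform of `μ`: the integral of a homogeneous monomial. -/
def mellin (μ : SMeas n) (E J : Finset (Fin n)) (a : Fin n → ℂ) : ℂ :=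
  μ.integral (monom E J a) (ContinuousLinearMap.lsmul ℝ ℝ).flip

/-- The Mellin transform of `μ` vanishes for all admissible exponents. -/
def MellinVanishes (μ : SMeas n) (E J : Finset (Fin n)) : Prop :=
  ∀ a, Admissible E a → mellin μ E J a = 0

lemma ConcentratedOn.ae {μ : SMeas n} {A : Set (Euc n)} (h : ConcentratedOn μ A)
    (hA : MeasurableSet A) : ∀ᵐ x ∂μ.variation, x ∈ A := by
  rw [ae_iff]
  exact (VectorMeasure.variation_apply_eq_zero (μ := μ) hA.compl).2 fun t ht hm => h t hm ht

lemma concentratedOn_of_ae {μ : SMeas n} {A : Set (Euc n)}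
    (h : ∀ᵐ x ∂μ.variation, x ∈ A) : ConcentratedOn μ A := by
  intro B _ hBA
  have h0 : μ.variation B = 0 := measure_mono_null hBA (ae_iff.1 h)
  have := VectorMeasure.enorm_measure_le_variation μ B
  rw [h0] at this
  simpa using this

lemma measurableSet_unitSphere : MeasurableSet (unitSphere n) :=
  Metric.isClosed_sphere.measurableSet

lemma measurableSet_sphStratum (E : Finset (Fin n)) : MeasurableSet (sphStratum E) :=
  (measurableSet_stratum E).inter measurableSet_unitSphere

lemma ConcentratedOn.mono {μ : SMeas n} {A B : Set (Euc n)} (h : ConcentratedOn μ A)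
    (hAB : A ⊆ B) : ConcentratedOn μ B :=
  fun C hC hCB => h C hC (hCB.trans (Set.compl_subset_compl.2 hAB))

lemma ConcentratedOn.ae_norm {μ : SMeas n} (h : ConcentratedOn μ (unitSphere n)) :
    ∀ᵐ x ∂μ.variation, ‖x‖ = 1 := by
  filter_upwards [h.ae measurableSet_unitSphere] with x hx
  simpa [unitSphere] using hx

lemma ConcentratedOn.boundedSupp {μ : SMeas n} (h : ConcentratedOn μ (unitSphere n)) :
    BoundedSupp μ :=
  ⟨1, by filter_upwards [h.ae_norm] with x hx using hx.le⟩

lemma BoundedSupp.integrable_norm {μ : SMeas n} (h : BoundedSupp μ) :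
    Integrable (fun x => ‖x‖) μ.variation := by
  obtain ⟨R, hR⟩ := h
  refine Integrable.of_bound (by fun_prop) R ?_
  filter_upwards [hR] with x hx
  simpa using hx

lemma integrable_monom {m : Measure (Euc n)} (hm : Integrable (fun x => ‖x‖) m)
    {E : Finset (Fin n)} (J : Finset (Fin n)) {a : Fin n → ℂ} (ha : Admissible E a) :
    Integrable (monom E J a) m :=
  hm.mono' (measurable_monom E J a).aestronglyMeasurable (.of_forall (norm_monom_le J ha))

lemma BoundedSupp.integrable_monom {μ : SMeas n} (h : BoundedSupp μ) {E : Finset (Fin n)}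
    (J : Finset (Fin n)) {a : Fin n → ℂ} (ha : Admissible E a) : μ.Integrable (monom E J a) :=
  SphConv.integrable_monom h.integrable_norm J ha

lemma BoundedSupp.map {μ : SMeas n} (h : BoundedSupp μ) {f : Euc n → Euc n} (hf : Measurable f)
    {C : ℝ} (hC : 0 ≤ C) (hfC : ∀ x, ‖f x‖ ≤ C * ‖x‖) : BoundedSupp (μ.map f) := by
  obtain ⟨R, hR⟩ := h
  refine ⟨C * R, ae_mono VectorMeasure.variation_map_le <| (ae_map_iff hf.aemeasurable
    (measurableSet_le measurable_norm measurable_const)).2 ?_⟩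
  filter_upwards [hR] with x hx
  exact (hfC x).trans (by gcongr)

lemma norm_coordProj_le (E : Finset (Fin n)) (x : Euc n) : ‖coordProj E x‖ ≤ ‖x‖ := by
  rw [EuclideanSpace.norm_eq, EuclideanSpace.norm_eq]
  gcongr with i
  simp only [coordProj]
  split_ifs <;> simp

lemma norm_reflect (E : Finset (Fin n)) (x : Euc n) : ‖reflect E x‖ = ‖x‖ := by
  rw [EuclideanSpace.norm_eq, EuclideanSpace.norm_eq]
  congr 2 with i
  simp only [reflect]
  split_ifs <;> simp

lemma norm_hadamard_le (x y : Euc n) : ‖hadamard x y‖ ≤ ‖x‖ * ‖y‖ := by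
  have h : ∀ i, ‖(hadamard x y) i‖ ≤ ‖‖x‖ • y i‖ := fun i => by
    simp only [hadamard, norm_mul, norm_smul, norm_norm]
    gcongr
    exact PiLp.norm_apply_le x i
  calc ‖hadamard x y‖ ≤ ‖‖x‖ • y‖ := by
        rw [EuclideanSpace.norm_eq, EuclideanSpace.norm_eq]
        gcongr with i
        exact h i
    _ = ‖x‖ * ‖y‖ := by rw [norm_smul, norm_norm]

lemma BoundedSupp.mulConv {μ ν : SMeas n} (hμ : BoundedSupp μ) (hν : BoundedSupp ν) :
    BoundedSupp (mulConv μ ν) := by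
  obtain ⟨R, hR⟩ := hμ
  obtain ⟨S, hS⟩ := hν
  refine ⟨|R| * |S|, ae_mono VectorMeasure.variation_map_le <|
    (ae_map_iff measurable_hadamard.aemeasurable
      (measurableSet_le measurable_norm measurable_const)).2 ?_⟩
  refine ae_mono VectorMeasure.variation_prod_le (Measure.ae_smul_measure ?_ _)
  have h1 := Measure.quasiMeasurePreserving_fst (μ := μ.variation) (ν := ν.variation) |>.ae hR
  have h2 := Measure.quasiMeasurePreserving_snd (μ := μ.variation) (ν := ν.variation) |>.ae hS
  filter_upwards [h1, h2] with p h1 h2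
  refine (norm_hadamard_le _ _).trans ?_
  gcongr
  · exact h1.trans (le_abs_self _)
  · exact h2.trans (le_abs_self _)

lemma BoundedSupp.restrict {μ : SMeas n} (h : BoundedSupp μ) (A : Set (Euc n)) :
    BoundedSupp (μ.restrict A) := by
  obtain ⟨R, hR⟩ := h
  exact ⟨R, ae_mono VectorMeasure.variation_restrict_le (ae_restrict_of_ae hR)⟩

lemma BoundedSupp.add {μ ν : SMeas n} (hμ : BoundedSupp μ) (hν : BoundedSupp ν) :
    BoundedSupp (μ + ν) := by
  obtain ⟨R, hR⟩ := hμ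
  obtain ⟨S, hS⟩ := hν
  refine ⟨max R S, ae_mono VectorMeasure.variation_add_le (ae_add_measure_iff.2 ⟨?_, ?_⟩)⟩
  · filter_upwards [hR] with x hx using hx.trans (le_max_left _ _)
  · filter_upwards [hS] with x hx using hx.trans (le_max_right _ _)

lemma BoundedSupp.smul {μ : SMeas n} (h : BoundedSupp μ) (c : ℝ) : BoundedSupp (c • μ) := by
  obtain ⟨R, hR⟩ := h
  refine ⟨R, ?_⟩
  rw [VectorMeasure.variation_smul]
  exact Measure.ae_smul_measure hR _

lemma boundedSupp_dirac (x : Euc n) (c : ℝ) : BoundedSupp (VectorMeasure.dirac x c) := by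
  refine ⟨‖x‖, ?_⟩
  rw [VectorMeasure.variation_dirac]
  refine Measure.ae_smul_measure ?_ _
  rw [ae_dirac_iff (measurableSet_le measurable_norm measurable_const)]

lemma boundedSupp_zero : BoundedSupp (0 : SMeas n) := ⟨0, by simp⟩

lemma boundedSupp_sum {ι : Type*} (s : Finset ι) (f : ι → SMeas n)
    (h : ∀ i ∈ s, BoundedSupp (f i)) : BoundedSupp (∑ i ∈ s, f i) :=
  Finset.sum_induction f BoundedSupp (fun _ _ => BoundedSupp.add) boundedSupp_zero h

/-! ### Mellin transforms and operations on measures -/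

lemma mellin_map {μ : SMeas n} (h : BoundedSupp μ) {f : Euc n → Euc n} (hf : Measurable f)
    {C : ℝ} (hfC : ∀ x, ‖f x‖ ≤ C * ‖x‖) {E J : Finset (Fin n)} {a : Fin n → ℂ}
    (ha : Admissible E a) :
    mellin (μ.map f) E J a =
      μ.integral (fun x => monom E J a (f x)) (ContinuousLinearMap.lsmul ℝ ℝ).flip := by
  refine VectorMeasure.integral_map hf (measurable_monom E J a).aestronglyMeasurable ?_
  refine (h.integrable_norm.const_mul C).mono'
    ((measurable_monom E J a).comp hf).aestronglyMeasurable (.of_forall fun x => ?_)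
  exact (norm_monom_le J ha _).trans (hfC x)

lemma mellin_add {μ ν : SMeas n} (hμ : BoundedSupp μ) (hν : BoundedSupp ν)
    {E J : Finset (Fin n)} {a : Fin n → ℂ} (ha : Admissible E a) :
    mellin (μ + ν) E J a = mellin μ E J a + mellin ν E J a :=
  VectorMeasure.integral_add_vectorMeasure (hμ.integrable_monom J ha) (hν.integrable_monom J ha)

lemma mellin_smul (c : ℝ) (μ : SMeas n) (E J : Finset (Fin n)) (a : Fin n → ℂ) :
    mellin (c • μ) E J a = c * mellin μ E J a := by
  rw [mellin, VectorMeasure.integral_smul_vectorMeasure, Complex.real_smul, mellin]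

lemma mellin_zero (E J : Finset (Fin n)) (a : Fin n → ℂ) : mellin (0 : SMeas n) E J a = 0 :=
  VectorMeasure.integral_zero_vectorMeasure

lemma mellin_sum {ι : Type*} (s : Finset ι) (f : ι → SMeas n) (h : ∀ i ∈ s, BoundedSupp (f i))
    {E J : Finset (Fin n)} {a : Fin n → ℂ} (ha : Admissible E a) :
    mellin (∑ i ∈ s, f i) E J a = ∑ i ∈ s, mellin (f i) E J a :=
  VectorMeasure.integral_finsetSum_vectorMeasure fun i hi => (h i hi).integrable_monom J ha

lemma mellin_dirac (x : Euc n) (c : ℝ) (E J : Finset (Fin n)) (a : Fin n → ℂ) :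
    mellin (VectorMeasure.dirac x c) E J a = c * monom E J a x := by
  rw [mellin, VectorMeasure.integral_dirac]
  simp

lemma mellin_restrict {μ : SMeas n} {A : Set (Euc n)} (hA : MeasurableSet A)
    {E J : Finset (Fin n)} {a : Fin n → ℂ}
    (h : ∀ᵐ x ∂μ.variation, x ∉ A → monom E J a x = 0) :
    mellin (μ.restrict A) E J a = mellin μ E J a :=
  VectorMeasure.setIntegral_eq_integral_of_ae_compl_eq_zero hA h

lemma mellin_eq_zero {μ : SMeas n} {E J : Finset (Fin n)} {a : Fin n → ℂ}
    (h : ∀ᵐ x ∂μ.variation, monom E J a x = 0) : mellin μ E J a = 0 :=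
  VectorMeasure.integral_eq_zero_of_ae h

/-! ### Reduction to positive measures by the Jordan decomposition -/

/-- The positive part of a signed measure. -/
abbrev pos (μ : SMeas n) : Measure (Euc n) := μ.toJordanDecomposition.posPart

/-- The negative part of a signed measure. -/
abbrev neg (μ : SMeas n) : Measure (Euc n) := μ.toJordanDecomposition.negPart

lemma pos_sub_neg (μ : SMeas n) : (pos μ).toSignedMeasure - (neg μ).toSignedMeasure = μ :=
  μ.toSignedMeasure_toJordanDecomposition

lemma pos_add_neg (μ : SMeas n) : pos μ + neg μ = μ.variation :=
  μ.totalVariation_eq_variation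

lemma pos_le (μ : SMeas n) : pos μ ≤ μ.variation := by
  rw [← pos_add_neg]; exact Measure.le_add_right le_rfl

lemma neg_le (μ : SMeas n) : neg μ ≤ μ.variation := by
  rw [← pos_add_neg]; exact Measure.le_add_left le_rfl

lemma integral_toSignedMeasure_sub {X : Type*} [MeasurableSpace X] {p q : Measure X}
    [IsFiniteMeasure p] [IsFiniteMeasure q]
    {f : X → ℂ} (hp : Integrable f p) (hq : Integrable f q) :
    (p.toSignedMeasure - q.toSignedMeasure).integral f (ContinuousLinearMap.lsmul ℝ ℝ).flip =
      ∫ x, f x ∂p - ∫ x, f x ∂q := by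
  rw [VectorMeasure.integral_sub_vectorMeasure, VectorMeasure.integral_toSignedMeasure,
    VectorMeasure.integral_toSignedMeasure]
  · rwa [VectorMeasure.Integrable, Measure.variation_toSignedMeasure]
  · rwa [VectorMeasure.Integrable, Measure.variation_toSignedMeasure]

lemma mellin_eq_sub {μ : SMeas n} (h : BoundedSupp μ) {E J : Finset (Fin n)} {a : Fin n → ℂ}
    (ha : Admissible E a) :
    mellin μ E J a = ∫ x, monom E J a x ∂pos μ - ∫ x, monom E J a x ∂neg μ := by
  have hi := h.integrable_monom J ha
  conv_lhs => rw [mellin, ← pos_sub_neg μ]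
  exact integral_toSignedMeasure_sub (hi.mono_measure (pos_le μ)) (hi.mono_measure (neg_le μ))

lemma apply_eq_sub (μ : SMeas n) {A : Set (Euc n)} (hA : MeasurableSet A) :
    μ A = (pos μ).real A - (neg μ).real A :=
  μ.apply_eq_posPart_real_sub_negPart_real hA

/-- A signed product is determined by its values on rectangles, where the identity is the expansion
of a product of two differences. It makes Fubini for positive measures available. -/
lemma prod_eq_toSignedMeasure_sub (μ ν : SMeas n) :
    VectorMeasure.prod μ ν (ContinuousLinearMap.lsmul ℝ ℝ) =
      ((pos μ).prod (pos ν) + (neg μ).prod (neg ν)).toSignedMeasure -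
      ((pos μ).prod (neg ν) + (neg μ).prod (pos ν)).toSignedMeasure := by
  refine VectorMeasure.prod_eq_of_forall_apply_prod fun s t hs ht => ?_
  rw [Measure.toSignedMeasure_sub_apply (hs.prod ht), measureReal_add_apply,
    measureReal_add_apply, measureReal_prod_prod, measureReal_prod_prod, measureReal_prod_prod,
    measureReal_prod_prod, apply_eq_sub μ hs, apply_eq_sub ν ht,
    ContinuousLinearMap.lsmul_apply, smul_eq_mul]
  ring

lemma mellin_mulConv {μ ν : SMeas n} (hμ : BoundedSupp μ) (hν : BoundedSupp ν)
    {E J : Finset (Fin n)} {a : Fin n → ℂ} (ha : Admissible E a) :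
    mellin (mulConv μ ν) E J a = mellin μ E J a * mellin ν E J a := by
  have iμ := hμ.integrable_monom J ha
  have iν := hν.integrable_monom J ha
  have ipp := (iμ.mono_measure (pos_le μ)).mul_prod (iν.mono_measure (pos_le ν))
  have ipn := (iμ.mono_measure (pos_le μ)).mul_prod (iν.mono_measure (neg_le ν))
  have inp := (iμ.mono_measure (neg_le μ)).mul_prod (iν.mono_measure (pos_le ν))
  have inn := (iμ.mono_measure (neg_le μ)).mul_prod (iν.mono_measure (neg_le ν))
  have key : mellin (mulConv μ ν) E J a =
      (VectorMeasure.prod μ ν (ContinuousLinearMap.lsmul ℝ ℝ)).integral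
        (fun p => monom E J a p.1 * monom E J a p.2) (ContinuousLinearMap.lsmul ℝ ℝ).flip := by
    rw [mellin, mulConv, VectorMeasure.integral_map measurable_hadamard
      (measurable_monom E J a).aestronglyMeasurable]
    · simp only [monom_hadamard]
    · have : Integrable (monom E J a ∘ fun p : Euc n × Euc n => hadamard p.1 p.2)
          (‖(ContinuousLinearMap.lsmul ℝ ℝ : ℝ →L[ℝ] ℝ →L[ℝ] ℝ)‖ₑ •
            μ.variation.prod ν.variation) := by
        refine Integrable.smul_measure ?_ (by simp)
        exact (iμ.mul_prod iν).congr (.of_forall fun p => (monom_hadamard E J a _ _).symm)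
      exact this.mono_measure VectorMeasure.variation_prod_le
  rw [key, prod_eq_toSignedMeasure_sub, integral_toSignedMeasure_sub (ipp.add_measure inn)
    (ipn.add_measure inp), integral_add_measure ipp inn, integral_add_measure ipn inp,
    integral_prod_mul, integral_prod_mul, integral_prod_mul, integral_prod_mul,
    mellin_eq_sub hμ ha, mellin_eq_sub hν ha]
  ring

lemma withDensity_norm_eq {μ : SMeas n} (h : BoundedSupp μ)
    [IsFiniteMeasure ((pos μ).withDensity fun x => ENNReal.ofReal ‖x‖)]
    [IsFiniteMeasure ((neg μ).withDensity fun x => ENNReal.ofReal ‖x‖)] :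
    μ.withDensity (fun x => ‖x‖) (ContinuousLinearMap.lsmul ℝ ℝ) =
      ((pos μ).withDensity fun x => ENNReal.ofReal ‖x‖).toSignedMeasure -
      ((neg μ).withDensity fun x => ENNReal.ofReal ‖x‖).toSignedMeasure := by
  -- Scalar multiplication on `ℝ` is commutative; this reconciles the two orders of the pairing in
  -- densities and integrals.
  have hflip : (ContinuousLinearMap.lsmul ℝ ℝ : ℝ →L[ℝ] ℝ →L[ℝ] ℝ) =
      (ContinuousLinearMap.lsmul ℝ ℝ).flip := by
    ext; simp
  ext s hs
  have hi := h.integrable_norm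
  have hip := hi.mono_measure (pos_le μ)
  have hin := hi.mono_measure (neg_le μ)
  rw [VectorMeasure.withDensity_apply hi, Measure.toSignedMeasure_sub_apply hs]
  have hr : μ.restrict s = ((pos μ).restrict s).toSignedMeasure -
      ((neg μ).restrict s).toSignedMeasure := by
    conv_lhs => rw [← pos_sub_neg μ]
    rw [VectorMeasure.restrict_sub, VectorMeasure.restrict_toSignedMeasure hs,
      VectorMeasure.restrict_toSignedMeasure hs]
  have key : ∀ p : Measure (Euc n), Integrable (fun x => ‖x‖) p →
      (p.withDensity fun x => ENNReal.ofReal ‖x‖).real s = ∫ x in s, ‖x‖ ∂p := by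
    intro p _
    rw [integral_eq_lintegral_of_nonneg_ae (.of_forall fun x => norm_nonneg x) (by fun_prop),
      measureReal_def, withDensity_apply _ hs]
  rw [key _ hip, key _ hin, hr, hflip, VectorMeasure.integral_sub_vectorMeasure,
    VectorMeasure.integral_toSignedMeasure, VectorMeasure.integral_toSignedMeasure]
  · rw [VectorMeasure.Integrable, Measure.variation_toSignedMeasure]; exact hip.restrict
  · rw [VectorMeasure.Integrable, Measure.variation_toSignedMeasure]; exact hin.restrict

lemma isFiniteMeasure_withDensity_norm {p : Measure (Euc n)} (hp : Integrable (fun x => ‖x‖) p) :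
    IsFiniteMeasure (p.withDensity fun x => ENNReal.ofReal ‖x‖) :=
  isFiniteMeasure_withDensity_ofReal hp.2

lemma mellin_radialProj {μ : SMeas n} (h : BoundedSupp μ)
    {E J : Finset (Fin n)} {a : Fin n → ℂ} (ha : Admissible E a) :
    mellin (radialProj μ) E J a = mellin μ E J a := by
  have hip := h.integrable_norm.mono_measure (pos_le μ)
  have hin := h.integrable_norm.mono_measure (neg_le μ)
  have := isFiniteMeasure_withDensity_norm hip
  have := isFiniteMeasure_withDensity_norm hin
  have hmeas : Measurable fun x : Euc n => ENNReal.ofReal ‖x‖ := by fun_prop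
  have hm : Measurable fun x => monom E J a (radial x) :=
    (measurable_monom E J a).comp measurable_radial
  have hsmul : ∀ x : Euc n, (ENNReal.ofReal ‖x‖).toReal • monom E J a (radial x) =
      monom E J a x := fun x => by
    rw [ENNReal.toReal_ofReal (norm_nonneg x), Complex.real_smul, norm_mul_monom_radial J ha]
  have hint : ∀ p : Measure (Euc n), Integrable (fun x => ‖x‖) p →
      Integrable (fun x => monom E J a (radial x))
        (p.withDensity fun x => ENNReal.ofReal ‖x‖) := by
    intro p hp
    rw [integrable_withDensity_iff_integrable_smul' hmeas (by simp)]
    simpa only [hsmul] using integrable_monom hp J ha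
  have hval : ∀ p : Measure (Euc n),
      ∫ x, monom E J a (radial x) ∂(p.withDensity fun x => ENNReal.ofReal ‖x‖) =
        ∫ x, monom E J a x ∂p := by
    intro p
    rw [integral_withDensity_eq_integral_toReal_smul hmeas (by simp)]
    simp only [hsmul]
  rw [mellin, radialProj, VectorMeasure.integral_map measurable_radial
    (measurable_monom E J a).aestronglyMeasurable, withDensity_norm_eq h,
    integral_toSignedMeasure_sub (hint _ hip) (hint _ hin), hval, hval, mellin_eq_sub h ha]
  rw [withDensity_norm_eq h]
  refine Integrable.mono_measure ?_ VectorMeasure.variation_sub_le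
  rw [Measure.variation_toSignedMeasure, Measure.variation_toSignedMeasure]
  exact (hint _ hip).add_measure (hint _ hin)

/-- The density `‖x‖` vanishes at the origin, so nothing has to be checked there. -/
lemma radialProj_ae {μ : SMeas n} (h : BoundedSupp μ) {P : Euc n → Prop}
    (hP : MeasurableSet {x | P x}) (hμ : ∀ᵐ x ∂μ.variation, x ≠ 0 → P (radial x)) :
    ∀ᵐ x ∂(radialProj μ).variation, P x := by
  refine ConcentratedOn.ae (A := {x | P x}) (fun B hB hBP => ?_) hP
  rw [radialProj_apply μ h.integrable_norm hB]
  refine VectorMeasure.setIntegral_eq_zero_of_ae_eq_zero ?_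
  filter_upwards [hμ] with x hx hxB
  by_contra h0
  exact hBP hxB (hx fun h => h0 (by simp [h]))

lemma norm_radial {x : Euc n} (hx : x ≠ 0) : ‖radial x‖ = 1 := by
  rw [radial, norm_smul, norm_inv, norm_norm, inv_mul_cancel₀ (norm_ne_zero_iff.2 hx)]

lemma radialProj_concentratedOn {μ : SMeas n} (h : BoundedSupp μ) :
    ConcentratedOn (radialProj μ) (unitSphere n) :=
  concentratedOn_of_ae <| radialProj_ae h measurableSet_unitSphere <| .of_forall fun x hx => by
    simp [unitSphere, norm_radial hx]

lemma sphConv_concentratedOn {μ ν : SMeas n} (hμ : BoundedSupp μ) (hν : BoundedSupp ν) :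
    ConcentratedOn (sphConv μ ν) (unitSphere n) :=
  radialProj_concentratedOn (hμ.mulConv hν)

lemma mellin_sphConv {μ ν : SMeas n} (hμ : BoundedSupp μ) (hν : BoundedSupp ν)
    {E J : Finset (Fin n)} {a : Fin n → ℂ} (ha : Admissible E a) :
    mellin (sphConv μ ν) E J a = mellin μ E J a * mellin ν E J a := by
  rw [sphConv, mellin_radialProj (hμ.mulConv hν) ha, mellin_mulConv hμ hν ha]

/-! ### Products of Mellin transforms -/

/-- Differentiability of an integral of holomorphic functions under an integrable bound. -/
lemma differentiableOn_integral_of_le {X : Type*} [MeasurableSpace X] {m : Measure X} {U : Set ℂ}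
    (hU : IsOpen U) {f : ℂ → X → ℂ} {g : X → ℝ} (hg : Integrable g m)
    (hf : ∀ z ∈ U, AEStronglyMeasurable (f z) m) (hfg : ∀ z ∈ U, ∀ x, ‖f z x‖ ≤ g x)
    (hd : ∀ x, DifferentiableOn ℂ (fun z => f z x) U) :
    DifferentiableOn ℂ (fun z => ∫ x, f z x ∂m) U := by
  intro z₀ hz₀
  obtain ⟨r, hr, hball⟩ := Metric.isOpen_iff.1 hU z₀ hz₀
  -- As `1/2 + 1/3 < 1`, these discs stay in `U`, and Cauchy's estimate on them bounds the
  -- derivative by `g x / (r / 3)`.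
  have hsub : ∀ z ∈ Metric.ball z₀ (r / 2), Metric.closedBall z (r / 3) ⊆ U := fun z hz w hw => by
    refine hball ?_
    rw [Metric.mem_ball] at hz ⊢
    rw [Metric.mem_closedBall] at hw
    linarith [dist_triangle w z z₀]
  have hderiv : ∀ x, ∀ z ∈ U, HasDerivAt (fun z => f z x) (deriv (fun z => f z x) z) z :=
    fun x z hz => ((hd x z hz).differentiableAt (hU.mem_nhds hz)).hasDerivAt
  -- The derivative is a limit of measurable difference quotients, with steps at most `r / 2` so
  -- that the points remain in `U`.
  have hmeas : AEStronglyMeasurable (fun x => deriv (fun z => f z x) z₀) m := by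
    have hlim : Filter.Tendsto (fun k : ℕ => (r / 2 / (k + 1) : ℝ)) Filter.atTop (nhds 0) := by
      simpa [div_eq_mul_inv] using
        (tendsto_one_div_add_atTop_nhds_zero_nat (𝕜 := ℝ)).const_mul (r / 2)
    have hpos : ∀ k : ℕ, 0 < r / 2 / ((k : ℝ) + 1) := fun k => by positivity
    have hle : ∀ k : ℕ, r / 2 / ((k : ℝ) + 1) ≤ r / 2 := fun k =>
      div_le_self (by positivity) (by linarith [k.cast_nonneg (α := ℝ)])
    refine aestronglyMeasurable_of_tendsto_ae Filter.atTop
      (f := fun (k : ℕ) x => ((r / 2 / ((k : ℝ) + 1) : ℝ) : ℂ)⁻¹ •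
        (f (z₀ + ((r / 2 / ((k : ℝ) + 1) : ℝ) : ℂ)) x - f z₀ x)) (fun k => ?_) ?_
    · refine AEStronglyMeasurable.fun_const_smul ((hf _ (hball ?_)).sub (hf _ hz₀)) _
      rw [Metric.mem_ball, dist_self_add_left, Complex.norm_real, Real.norm_of_nonneg (hpos k).le]
      linarith [hle k]
    · refine .of_forall fun x => (hderiv x z₀ hz₀).tendsto_slope_zero.comp ?_
      refine tendsto_nhdsWithin_iff.2 ⟨?_, .of_forall fun k => ?_⟩
      · exact (Complex.continuous_ofReal.tendsto 0).comp hlim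
      · exact Complex.ofReal_ne_zero.2 (hpos k).ne'
  refine (hasDerivAt_integral_of_dominated_loc_of_deriv_le (F := f)
    (F' := fun z x => deriv (fun z => f z x) z) (bound := fun x => g x / (r / 3))
    (Metric.ball_mem_nhds z₀ (half_pos hr)) ?_ ?_ hmeas ?_ (hg.div_const _)
    ?_).2.differentiableAt.differentiableWithinAt
  · filter_upwards [hU.mem_nhds hz₀] with z hz using hf z hz
  · exact hg.mono' (hf _ hz₀) (.of_forall (hfg _ hz₀))
  · refine .of_forall fun x z hz => ?_
    refine Complex.norm_deriv_le_of_forall_mem_sphere_norm_le (by positivity) ?_ fun w hw =>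
      hfg w (hsub z hz (Metric.sphere_subset_closedBall hw)) x
    exact ((hd x).mono (hsub z hz)).diffContOnCl_ball subset_rfl
  · exact .of_forall fun x z hz =>
      hderiv x z (hsub z hz (Metric.mem_closedBall_self (by positivity)))

lemma differentiableOn_signPow (j : Prop) [Decidable j] (t : ℝ) {U : Set ℂ} {l : ℂ → ℂ}
    (hl : Differentiable ℂ l) (hU : ∀ z ∈ U, l z ≠ 0) :
    DifferentiableOn ℂ (fun z => signPow j (l z) t) U := by
  rcases eq_or_ne t 0 with rfl | ht
  · refine (differentiableOn_const (0 : ℂ)).congr fun z hz => signPow_zero j (hU z hz)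
  · unfold signPow
    refine ((hl.const_cpow (Or.inl ?_)).const_mul _).differentiableOn
    exact_mod_cast (abs_pos.2 ht).ne'

/-- The complex line through two systems of exponents. -/
def exponentLine (a b : Fin n → ℂ) (z : ℂ) : Fin n → ℂ := fun k => a k + z * (b k - a k)

/-- The parameters of the line at which the real parts of the exponents in `E` are positive. -/
def lineDomain (E : Finset (Fin n)) (a b : Fin n → ℂ) : Set ℂ :=
  {z | ∀ k ∈ E, 0 < (exponentLine a b z k).re}

lemma isOpen_lineDomain (E : Finset (Fin n)) (a b : Fin n → ℂ) : IsOpen (lineDomain E a b) := by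
  have : lineDomain E a b = ⋂ k ∈ E, {z | 0 < (exponentLine a b z k).re} := by
    ext z; simp [lineDomain]
  rw [this]
  refine isOpen_biInter_finset fun k _ => isOpen_lt continuous_const ?_
  unfold exponentLine
  fun_prop

lemma convex_lineDomain (E : Finset (Fin n)) (a b : Fin n → ℂ) : Convex ℝ (lineDomain E a b) := by
  intro z hz w hw s t hs ht hst k hk
  have h : (exponentLine a b (s • z + t • w) k).re =
      s * (exponentLine a b z k).re + t * (exponentLine a b w k).re := by
    have : exponentLine a b (s • z + t • w) k =
        (s : ℂ) * exponentLine a b z k + (t : ℂ) * exponentLine a b w k := by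
      have hst' : (s : ℂ) + t = 1 := by exact_mod_cast hst
      simp only [exponentLine, Complex.real_smul]
      linear_combination -(a k) * hst'
    rw [this, Complex.add_re, Complex.re_ofReal_mul, Complex.re_ofReal_mul]
  rw [h]
  have hz := hz k hk
  have hw := hw k hk
  -- At least one of the two weights is positive, which gives strict positivity.
  rcases hs.eq_or_lt with rfl | hs
  · obtain rfl : t = 1 := by linarith
    simpa using hw
  · positivity

lemma admissible_exponentLine {E : Finset (Fin n)} {a b : Fin n → ℂ} (ha : Admissible E a)
    (hb : Admissible E b) {z : ℂ} (hz : z ∈ lineDomain E a b) :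
    Admissible E (exponentLine a b z) := by
  refine ⟨hz, ?_⟩
  simp only [exponentLine, Finset.sum_add_distrib, ← Finset.mul_sum, Finset.sum_sub_distrib,
    ha.sum_eq, hb.sum_eq]
  ring

/-- Each monomial is holomorphic in the parameter and bounded by `‖x‖` uniformly, so the integrals
against both Jordan parts are holomorphic. -/
lemma analyticOnNhd_mellin {μ : SMeas n} (h : BoundedSupp μ) {E : Finset (Fin n)}
    (J : Finset (Fin n)) {a b : Fin n → ℂ} (ha : Admissible E a) (hb : Admissible E b) :
    AnalyticOnNhd ℂ (fun z => mellin μ E J (exponentLine a b z)) (lineDomain E a b) := by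
  have key : ∀ p : Measure (Euc n), Integrable (fun x => ‖x‖) p →
      DifferentiableOn ℂ (fun z => ∫ x, monom E J (exponentLine a b z) x ∂p)
        (lineDomain E a b) := by
    intro p hp
    refine differentiableOn_integral_of_le (isOpen_lineDomain E a b) hp
      (fun z _ => (measurable_monom _ _ _).aestronglyMeasurable)
      (fun z hz x => norm_monom_le J (admissible_exponentLine ha hb hz) x) fun x => ?_
    unfold monom
    refine DifferentiableOn.fun_finsetProd fun k hk => ?_
    refine differentiableOn_signPow (k ∈ J) (x k) (l := fun z => exponentLine a b z k) ?_
      fun z hz => (admissible_exponentLine ha hb hz).ne_zero hk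
    unfold exponentLine
    fun_prop
  refine DifferentiableOn.analyticOnNhd ?_ (isOpen_lineDomain E a b)
  refine ((key _ (h.integrable_norm.mono_measure (pos_le μ))).sub
    (key _ (h.integrable_norm.mono_measure (neg_le μ)))).congr fun z hz => ?_
  exact mellin_eq_sub h (admissible_exponentLine ha hb hz)

/-- Mellin transforms form an integral domain. -/
lemma mellinVanishes_or {μ ν : SMeas n} (hμ : BoundedSupp μ) (hν : BoundedSupp ν)
    {E J : Finset (Fin n)}
    (h : ∀ a, Admissible E a → mellin μ E J a * mellin ν E J a = 0) :
    MellinVanishes μ E J ∨ MellinVanishes ν E J := by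
  by_contra hcon
  simp only [MellinVanishes, not_or, not_forall] at hcon
  obtain ⟨⟨a, ha, hμa⟩, ⟨b, hb, hνb⟩⟩ := hcon
  -- The exponents witnessing that neither transform vanishes lie on one complex line, at parameters
  -- 0 and 1. Its admissible domain is convex, hence connected, so the identity theorem applies.
  have h0 : exponentLine a b 0 = a := by ext; simp [exponentLine]
  have h1 : exponentLine a b 1 = b := by ext; simp [exponentLine]
  rcases (analyticOnNhd_mellin hμ J ha hb).eq_zero_or_eq_zero_of_mul_eq_zero
    (analyticOnNhd_mellin hν J ha hb)
    (fun z hz => h _ (admissible_exponentLine ha hb hz))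
    (convex_lineDomain E a b).isPreconnected with hz | hz
  · exact hμa (by simpa [h0] using hz 0 fun k hk => by rw [h0]; exact ha.re_pos k hk)
  · exact hνb (by simpa [h1] using hz 1 fun k hk => by rw [h1]; exact hb.re_pos k hk)

/-! ### Boundary values of the Mellin transform -/

/-- Let the exponents outside `F` tend to zero: `|x_k| ^ a k` tends to one because `x_k ≠ 0`, with
dominating function `‖x‖`. The condition `J ⊆ F` ensures that no sign factor of a removed coordinate
survives. -/
lemma MellinVanishes.of_subset {μ : SMeas n} (h : BoundedSupp μ) {E F J : Finset (Fin n)}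
    (hx : ∀ᵐ x ∂μ.variation, ∀ k ∈ E, x k ≠ 0) (hv : MellinVanishes μ E J)
    (hJF : J ⊆ F) (hFE : F ⊆ E) : MellinVanishes μ F J := by
  intro a ha
  have hE : E.Nonempty := ha.nonempty.mono hFE
  set c : ℂ := Complex.ofReal (E.card : ℝ)⁻¹
  -- Extended by zero, the exponents may lie on the boundary of the admissible set of `E`; mixing in
  -- weight `ε` of the constant exponents moves them inside.
  set a' : Fin n → ℂ := fun k => if k ∈ F then a k else 0
  have ha' : ∑ k ∈ E, a' k = 1 := by
    rw [← Finset.sum_filter, Finset.filter_mem_eq_inter, Finset.inter_eq_right.2 hFE, ha.sum_eq]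
  have hc := admissible_const hE
  let ε : ℕ → ℝ := fun i => 1 / ((i : ℝ) + 1)
  have hε : Filter.Tendsto ε Filter.atTop (nhds 0) := tendsto_one_div_add_atTop_nhds_zero_nat
  have hε0 : ∀ i, 0 < ε i := fun i => by positivity
  have hε1 : ∀ i, ε i ≤ 1 := fun i => by
    rw [div_le_one (by positivity)]; linarith [i.cast_nonneg (α := ℝ)]
  have hadm : ∀ i, Admissible E (exponentLine a' (fun _ => c) (ε i)) := by
    refine fun i => ⟨fun k hk => ?_, ?_⟩
    · have h0 : 0 ≤ (a' k).re := by
        simp only [a']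
        split_ifs with hk
        · exact (ha.re_pos k hk).le
        · simp
      have h1 : 0 < c.re := hc.re_pos k hk
      have h2 : (exponentLine a' (fun _ => c) (ε i) k).re =
          (1 - ε i) * (a' k).re + ε i * c.re := by
        simp only [exponentLine, Complex.add_re, Complex.re_ofReal_mul, Complex.sub_re]
        ring
      rw [h2]
      have := mul_nonneg (sub_nonneg.2 (hε1 i)) h0
      have := mul_pos (hε0 i) h1
      linarith
    · simp only [exponentLine, Finset.sum_add_distrib, ← Finset.mul_sum, Finset.sum_sub_distrib,
        ha']
      rw [hc.sum_eq]
      ring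
  have hlim : Filter.Tendsto (fun i => mellin μ E J (exponentLine a' (fun _ => c) (ε i)))
      Filter.atTop (nhds (mellin μ F J a)) := by
    refine VectorMeasure.tendsto_integral_filter_of_dominated_convergence (fun x => ‖x‖)
      (.of_forall fun i => (measurable_monom _ _ _).aestronglyMeasurable)
      (.of_forall fun i => .of_forall fun x => norm_monom_le J (hadm i) x) h.integrable_norm ?_
    filter_upwards [hx] with x hx
    have h1 : monom F J a x = ∏ k ∈ E, signPow (k ∈ J) (a' k) (x k) := by
      unfold monom
      rw [← Finset.prod_subset hFE (f := fun k => signPow (k ∈ J) (a' k) (x k))]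
      · exact Finset.prod_congr rfl fun k hk => by simp [a', hk]
      · intro k _ hk
        have hkJ : k ∉ J := fun h => hk (hJF h)
        simp [signPow, a', hk, hkJ]
    rw [h1]
    refine tendsto_finsetProd _ fun k hk => ?_
    unfold signPow
    refine Filter.Tendsto.const_mul _ ?_
    refine Filter.Tendsto.const_cpow ?_ (Or.inl ?_)
    · have : Filter.Tendsto (fun i => a' k + (ε i : ℂ) * (c - a' k)) Filter.atTop
          (nhds (a' k + ((0 : ℝ) : ℂ) * (c - a' k))) :=
        (((Complex.continuous_ofReal.tendsto 0).comp hε).mul_const _).const_add _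
      simpa [exponentLine] using this
    · exact_mod_cast (abs_pos.2 (hx k hk)).ne'
  exact tendsto_nhds_unique hlim (by simp [hv _ (hadm _)])

/-! ### Uniqueness for Mellin transforms -/

/-- The mean of `log |x_k|` over `k ∈ E`. -/
def logMean (E : Finset (Fin n)) (x : Euc n) : ℝ := (∑ k ∈ E, Real.log |x k|) / E.card

/-- Logarithmic polar coordinates: centred logarithms and signs of the coordinates in `E`. -/
def logSign (E : Finset (Fin n)) (x : Euc n) : EuclideanSpace ℝ (Fin n ⊕ Fin n) :=
  WithLp.toLp 2 (Sum.elim (fun k => if k ∈ E then Real.log |x k| - logMean E x else 0) fun k => Real.sign (x k))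

/-- A left inverse of `logSign E` on `sphStratum E`. -/
def expSign (E : Finset (Fin n)) (y : EuclideanSpace ℝ (Fin n ⊕ Fin n)) : Euc n :=
  radial (WithLp.toLp 2 fun k => if k ∈ E then y (Sum.inr k) * Real.exp (y (Sum.inl k)) else 0)

lemma measurable_logMean (E : Finset (Fin n)) : Measurable (logMean E) := by
  unfold logMean
  fun_prop

lemma measurable_logSign (E : Finset (Fin n)) : Measurable (logSign E) := by
  have := measurable_logMean E
  unfold logSign
  refine (WithLp.measurable_toLp 2 _).comp (measurable_pi_lambda _ fun i => ?_)
  rcases i with k | k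
  · by_cases h : k ∈ E <;> simp only [Sum.elim_inl, h, if_true, if_false] <;> fun_prop
  · exact measurable_real_sign.comp (by fun_prop)

lemma measurable_expSign (E : Finset (Fin n)) : Measurable (expSign E) := by
  unfold expSign
  refine measurable_radial.comp
    ((WithLp.measurable_toLp 2 _).comp (measurable_pi_lambda _ fun k => ?_))
  by_cases h : k ∈ E <;> simp only [h, if_true, if_false] <;> fun_prop

lemma real_sign_mul_abs (t : ℝ) : Real.sign t * |t| = t := by
  rcases lt_trichotomy t 0 with h | h | h <;>
    simp [h, Real.sign_of_neg, Real.sign_of_pos, abs_of_neg, abs_of_pos]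

lemma radial_smul {c : ℝ} (hc : 0 < c) {x : Euc n} (hx : ‖x‖ = 1) : radial (c • x) = x := by
  rw [radial, norm_smul, hx, mul_one, Real.norm_of_nonneg hc.le, smul_smul,
    inv_mul_cancel₀ hc.ne', one_smul]

/-- Centring the logarithms only loses a positive scalar factor, which is recovered by normalising
to length one. -/
lemma expSign_logSign {E : Finset (Fin n)} {x : Euc n} (hx : x ∈ stratum E) (h1 : ‖x‖ = 1) :
    expSign E (logSign E x) = x := by
  have key : (WithLp.toLp 2 fun k => if k ∈ E then
      (logSign E x) (Sum.inr k) * Real.exp ((logSign E x) (Sum.inl k)) else 0 : Euc n) =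
      Real.exp (-logMean E x) • x := by
    ext k
    simp only [logSign, Sum.elim_inl, Sum.elim_inr, PiLp.smul_apply, smul_eq_mul]
    by_cases hk : k ∈ E
    · rw [if_pos hk]
      have h0 : x k ≠ 0 := (hx k).2 hk
      rw [if_pos hk, sub_eq_add_neg, Real.exp_add, Real.exp_log (abs_pos.2 h0), ← mul_assoc,
        real_sign_mul_abs, mul_comm]
    · rw [if_neg hk, not_not.1 (mt (hx k).1 hk), mul_zero]
  rw [expSign, key, radial_smul (Real.exp_pos _) h1]

/-! ### Mellin transforms as characteristic functions in logarithmic coordinates -/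

/-- The geometric mean of `|x_k|` over `k ∈ E`, for `x` in the stratum of `E`. -/
def geomMean (E : Finset (Fin n)) (x : Euc n) : ℝ := Real.exp (logMean E x)

/-- The exponents which give rise to the characteristic function in logarithmic coordinates. -/
def fourierExponent (E : Finset (Fin n)) (t : Fin n → ℝ) (k : Fin n) : ℂ :=
  ((E.card : ℝ)⁻¹ : ℝ) + ((t k - (∑ i ∈ E, t i) / E.card : ℝ) : ℂ) * Complex.I

/-- The real parts are all `1 / |E|`, and the imaginary parts are centred so as to cancel in the
sum. -/
lemma admissible_fourierExponent {E : Finset (Fin n)} (hE : E.Nonempty) (t : Fin n → ℝ) :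
    Admissible E (fourierExponent E t) := by
  have hc := admissible_const hE
  have h0 : (E.card : ℝ) ≠ 0 := by exact_mod_cast hE.card_pos.ne'
  refine ⟨fun k hk => ?_, ?_⟩
  · have := hc.re_pos k hk
    simpa [fourierExponent] using this
  · have hs : ∑ k ∈ E, (t k - (∑ i ∈ E, t i) / E.card) = 0 := by
      rw [Finset.sum_sub_distrib, Finset.sum_const, nsmul_eq_mul]
      field_simp
      simp
    simp only [fourierExponent]
    rw [Finset.sum_add_distrib, hc.sum_eq, ← Finset.sum_mul, ← Complex.ofReal_sum, hs]
    simp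

/-- The coefficients of the monomials in the expansion of the characteristic function. -/
def signCoeff (E : Finset (Fin n)) (u : Fin n → ℝ) (J : Finset (Fin n)) : ℂ :=
  (∏ k ∈ J, Complex.I * Real.sin (u k)) * ∏ k ∈ E \ J, (Real.cos (u k) : ℂ)

lemma exp_sign_mul_I {s : ℝ} (hs : s ≠ 0) (u : ℝ) :
    Complex.exp ((Real.sign s * u : ℝ) * Complex.I) =
      Complex.I * Real.sin u * Real.sign s + Real.cos u := by
  rw [Complex.exp_mul_I, ← Complex.ofReal_cos, ← Complex.ofReal_sin]
  rcases hs.lt_or_gt with h | h <;> simp [h, Real.sign_of_neg, Real.sign_of_pos] <;> ring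

lemma monom_eq_mul_prod {E J : Finset (Fin n)} (hJ : J ⊆ E) (a : Fin n → ℂ) {x : Euc n}
    (hx : ∀ k ∈ E, x k ≠ 0) :
    monom E J a x = (∏ k ∈ J, (Real.sign (x k) : ℂ)) *
      Complex.exp (∑ k ∈ E, Real.log |x k| * a k) := by
  unfold monom signPow
  rw [Finset.prod_mul_distrib, Finset.prod_ite, Finset.prod_const_one, mul_one,
    Finset.filter_mem_eq_inter, Finset.inter_eq_right.2 hJ, Complex.exp_sum]
  congr 1
  refine Finset.prod_congr rfl fun k hk => ?_
  rw [Complex.cpow_def_of_ne_zero (Complex.ofReal_ne_zero.2 (abs_pos.2 (hx k hk)).ne'),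
    Complex.ofReal_log (abs_nonneg _)]

lemma inner_logSign {E : Finset (Fin n)} {x : Euc n} (hx : x ∈ stratum E)
    (v : EuclideanSpace ℝ (Fin n ⊕ Fin n)) :
    inner ℝ (logSign E x) v = ∑ k ∈ E, (Real.log |x k| - logMean E x) * v (Sum.inl k) +
      ∑ k ∈ E, Real.sign (x k) * v (Sum.inr k) := by
  rw [PiLp.inner_apply, Fintype.sum_sum_type]
  congr 1
  · rw [← Finset.sum_subset E.subset_univ]
    · exact Finset.sum_congr rfl fun k hk => by simp [logSign, hk, mul_comm]
    · intro k _ hk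
      simp [logSign, hk]
  · rw [← Finset.sum_subset E.subset_univ]
    · exact Finset.sum_congr rfl fun k hk => by simp [logSign, mul_comm]
    · intro k _ hk
      have h0 : x k = 0 := not_not.1 (mt (hx k).1 hk)
      simp [logSign, h0]

lemma sum_log_mul_fourierExponent {E : Finset (Fin n)} (t : Fin n → ℝ) (x : Euc n) :
    ∑ k ∈ E, (Real.log |x k| : ℂ) * fourierExponent E t k =
      logMean E x + (∑ k ∈ E, (Real.log |x k| - logMean E x) * t k : ℝ) * Complex.I := by
  have h1 : ∑ k ∈ E, (Real.log |x k| : ℂ) * fourierExponent E t k =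
      (∑ k ∈ E, Real.log |x k| * (E.card : ℝ)⁻¹ : ℝ) +
        (∑ k ∈ E, Real.log |x k| * (t k - (∑ i ∈ E, t i) / E.card) : ℝ) * Complex.I := by
    rw [Complex.ofReal_sum, Complex.ofReal_sum, Finset.sum_mul, ← Finset.sum_add_distrib]
    refine Finset.sum_congr rfl fun k _ => ?_
    simp only [fourierExponent]
    push_cast
    ring
  have h2 : ∑ k ∈ E, Real.log |x k| * (t k - (∑ i ∈ E, t i) / E.card) =
      ∑ k ∈ E, (Real.log |x k| - logMean E x) * t k := by
    simp only [mul_sub, sub_mul, Finset.sum_sub_distrib, ← Finset.sum_mul, ← Finset.mul_sum,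
      logMean]
    ring
  rw [h1, h2, ← Finset.sum_mul, logMean, div_eq_mul_inv]

/-- By Euler's formula the sign coordinates contribute `∏ (i sin u_k sign x_k + cos u_k)`; expanding
over subsets `J` yields the sign twists. The geometric mean comes from the real parts of the
exponents, the logarithmic phase from the imaginary parts. -/
lemma geomMean_mul_cexp {E : Finset (Fin n)} {x : Euc n} (hx : x ∈ stratum E)
    (v : EuclideanSpace ℝ (Fin n ⊕ Fin n)) :
    (geomMean E x : ℂ) * Complex.exp (inner ℝ (logSign E x) v * Complex.I) =
      ∑ J ∈ E.powerset, signCoeff E (fun k => v (Sum.inr k)) J *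
        monom E J (fourierExponent E fun k => v (Sum.inl k)) x := by
  have hx0 : ∀ k ∈ E, x k ≠ 0 := fun k hk => (hx k).2 hk
  have h1 : ∀ J ∈ E.powerset, signCoeff E (fun k => v (Sum.inr k)) J *
        monom E J (fourierExponent E fun k => v (Sum.inl k)) x =
      ((∏ k ∈ J, Complex.I * Real.sin (v (Sum.inr k)) * Real.sign (x k)) *
        ∏ k ∈ E \ J, (Real.cos (v (Sum.inr k)) : ℂ)) *
        Complex.exp (∑ k ∈ E, Real.log |x k| * fourierExponent E (fun k => v (Sum.inl k)) k) := by
    intro J hJ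
    rw [monom_eq_mul_prod (Finset.mem_powerset.1 hJ) _ hx0, signCoeff,
      Finset.prod_mul_distrib (g := fun k => (Real.sign (x k) : ℂ))]
    ring
  rw [Finset.sum_congr rfl h1, ← Finset.sum_mul, ← Finset.prod_add, sum_log_mul_fourierExponent,
    ← Finset.prod_congr rfl fun k hk => exp_sign_mul_I (hx0 k hk) (v (Sum.inr k)),
    ← Complex.exp_sum, ← Complex.exp_add, inner_logSign hx, geomMean, Complex.ofReal_exp,
    ← Complex.exp_add]
  congr 1
  push_cast
  rw [← Finset.sum_mul]
  ring

lemma measurable_geomMean (E : Finset (Fin n)) : Measurable (geomMean E) :=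
  Real.measurable_exp.comp (measurable_logMean E)

/-- The weighted measure whose image in logarithmic coordinates is characterised by its
characteristic function. -/
def geomWeighted (E : Finset (Fin n)) (p : Measure (Euc n)) : Measure (Euc n) :=
  p.withDensity fun x => ENNReal.ofReal (geomMean E x)

lemma geomMean_eq_monom {E : Finset (Fin n)} {x : Euc n} (hx : x ∈ stratum E) :
    (geomMean E x : ℂ) = monom E ∅ (fun _ => ((E.card : ℝ)⁻¹ : ℝ)) x := by
  rw [monom_eq_mul_prod (Finset.empty_subset _) _ fun k hk => (hx k).2 hk, Finset.prod_empty,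
    one_mul, ← Finset.sum_mul, geomMean, logMean]
  push_cast
  rw [div_eq_mul_inv]

lemma isFiniteMeasure_geomWeighted {p : Measure (Euc n)} [IsFiniteMeasure p]
    {E : Finset (Fin n)} (hE : E.Nonempty) (hp : ∀ᵐ x ∂p, x ∈ sphStratum E) :
    IsFiniteMeasure (geomWeighted E p) := by
  refine isFiniteMeasure_withDensity_ofReal (Integrable.of_bound
    (measurable_geomMean E).aestronglyMeasurable 1 ?_).2
  filter_upwards [hp] with x hx
  have h := norm_monom_le ∅ (admissible_const hE) x
  rwa [← geomMean_eq_monom hx.1, Complex.norm_real, mem_sphere_zero_iff_norm.1 hx.2] at h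

lemma charFun_map_geomWeighted {p : Measure (Euc n)} [IsFiniteMeasure p]
    {E : Finset (Fin n)} (hE : E.Nonempty) (hp : ∀ᵐ x ∂p, x ∈ sphStratum E)
    (v : EuclideanSpace ℝ (Fin n ⊕ Fin n)) :
    charFun ((geomWeighted E p).map (logSign E)) v =
      ∑ J ∈ E.powerset, signCoeff E (fun k => v (Sum.inr k)) J *
        ∫ x, monom E J (fourierExponent E fun k => v (Sum.inl k)) x ∂p := by
  have hn : Integrable (fun x => ‖x‖) p := by
    refine Integrable.of_bound (by fun_prop) 1 ?_
    filter_upwards [hp] with x hx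
    rw [norm_norm, mem_sphere_zero_iff_norm.1 hx.2]
  rw [charFun_apply, integral_map (measurable_logSign E).aemeasurable (by fun_prop), geomWeighted,
    integral_withDensity_eq_integral_toReal_smul
      (measurable_geomMean E).ennreal_ofReal (by simp)]
  simp_rw [← integral_const_mul]
  rw [← integral_finsetSum _ fun J _ =>
    (integrable_monom hn J (admissible_fourierExponent hE _)).const_mul _]
  refine integral_congr_ae ?_
  filter_upwards [hp] with x hx
  rw [← geomMean_mul_cexp hx.1, ENNReal.toReal_ofReal (show 0 ≤ geomMean E x from (Real.exp_pos _).le),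
    Complex.real_smul]

lemma map_logSign_geomWeighted {p : Measure (Euc n)} {E : Finset (Fin n)}
    (hp : ∀ᵐ x ∂p, x ∈ sphStratum E) :
    ((geomWeighted E p).map (logSign E)).map (expSign E) = geomWeighted E p := by
  rw [Measure.map_map (measurable_expSign E) (measurable_logSign E)]
  conv_rhs => rw [← Measure.map_id (μ := geomWeighted E p)]
  refine Measure.map_congr ?_
  filter_upwards [(withDensity_absolutelyContinuous p _).ae_le hp] with x hx
  exact expSign_logSign hx.1 (mem_sphere_zero_iff_norm.1 hx.2)

lemma geomWeighted_injective {p q : Measure (Euc n)} {E : Finset (Fin n)}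
    (h : geomWeighted E p = geomWeighted E q) : p = q := by
  have key : ∀ r : Measure (Euc n), (geomWeighted E r).withDensity
      (fun x => (ENNReal.ofReal (geomMean E x))⁻¹) = r := fun r =>
    withDensity_inv_same (ENNReal.measurable_ofReal.comp (measurable_geomMean E))
      (.of_forall fun x => by simp [geomMean, Real.exp_pos]) (.of_forall fun x => by simp)
  rw [← key p, h, key q]

/-- The monomial integrals determine the characteristic functions of the weighted measures in
logarithmic coordinates. These coordinates are injective on the spherical stratum, and the weight is
positive, so both can be undone. -/
lemma eq_of_integral_monom_eq {p q : Measure (Euc n)} [IsFiniteMeasure p] [IsFiniteMeasure q]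
    {E : Finset (Fin n)} (hE : E.Nonempty) (hp : ∀ᵐ x ∂p, x ∈ sphStratum E)
    (hq : ∀ᵐ x ∂q, x ∈ sphStratum E)
    (h : ∀ J ⊆ E, ∀ a, Admissible E a → ∫ x, monom E J a x ∂p = ∫ x, monom E J a x ∂q) :
    p = q := by
  have := isFiniteMeasure_geomWeighted hE hp
  have := isFiniteMeasure_geomWeighted hE hq
  have hmap : (geomWeighted E p).map (logSign E) = (geomWeighted E q).map (logSign E) := by
    refine Measure.ext_of_charFun (funext fun v => ?_)
    rw [charFun_map_geomWeighted hE hp, charFun_map_geomWeighted hE hq]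
    refine Finset.sum_congr rfl fun J hJ => ?_
    rw [h J (Finset.mem_powerset.1 hJ) _ (admissible_fourierExponent hE _)]
  refine geomWeighted_injective (E := E) ?_
  rw [← map_logSign_geomWeighted hp, hmap, map_logSign_geomWeighted hq]

/-! ### Separating the strata -/

lemma mem_stratum_iff {E : Finset (Fin n)} {x : Euc n} :
    x ∈ stratum E ↔ Finset.univ.filter (fun k => x k ≠ 0) = E := by
  simp [stratum, Finset.ext_iff]

lemma pairwise_disjoint_stratum :
    Pairwise (Function.onFun Disjoint (stratum : Finset (Fin n) → Set (Euc n))) := by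
  intro E F hEF
  refine Set.disjoint_left.2 fun x hE hF => hEF ?_
  rw [← mem_stratum_iff.1 hE, mem_stratum_iff.1 hF]

lemma iUnion_stratum : ⋃ E, stratum (n := n) E = Set.univ :=
  Set.eq_univ_of_forall fun _ => Set.mem_iUnion.2 ⟨_, mem_stratum_iff.2 rfl⟩

/-- Induction from large index sets to small ones: a monomial of `E` vanishes on the stratum of `F`
unless `E ⊆ F`, and the strictly larger `F` are already settled, so their contributions cancel. -/
lemma restrict_stratum_eq {p q : Measure (Euc n)} [IsFiniteMeasure p] [IsFiniteMeasure q]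
    (hp : ∀ᵐ x ∂p, ‖x‖ = 1) (hq : ∀ᵐ x ∂q, ‖x‖ = 1)
    (h : ∀ E J : Finset (Fin n), J ⊆ E → ∀ a, Admissible E a →
      ∫ x, monom E J a x ∂p = ∫ x, monom E J a x ∂q) (E : Finset (Fin n)) :
    p.restrict (stratum E) = q.restrict (stratum E) := by
  have hsph : ∀ r : Measure (Euc n), (∀ᵐ x ∂r, ‖x‖ = 1) → ∀ F : Finset (Fin n),
      ∀ᵐ x ∂r.restrict (stratum F), x ∈ sphStratum F := by
    intro r hr F
    filter_upwards [ae_restrict_of_ae hr, ae_restrict_mem (measurableSet_stratum F)] with x h1 h2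
    exact ⟨h2, mem_sphere_zero_iff_norm.2 h1⟩
  induction hk : Eᶜ.card using Nat.strong_induction_on generalizing E with
  | _ k ih =>
  rcases E.eq_empty_or_nonempty with rfl | hE
  -- The stratum of the empty set is the origin, which is not on the sphere.
  · have h0 : ∀ r : Measure (Euc n), (∀ᵐ x ∂r, ‖x‖ = 1) → r.restrict (stratum ∅) = 0 := by
      intro r hr
      rw [← ae_eq_bot, ← Filter.empty_mem_iff_bot]
      filter_upwards [hsph r hr ∅] with x hx
      have hx0 : x = 0 := by
        ext k
        simpa using hx.1 k
      simpa [hx0, unitSphere] using hx.2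
    rw [h0 p hp, h0 q hq]
  · refine eq_of_integral_monom_eq hE (hsph p hp E) (hsph q hq E) fun J hJ a ha => ?_
    have hsum : ∀ r : Measure (Euc n), IsFiniteMeasure r → (∀ᵐ x ∂r, ‖x‖ = 1) →
        ∫ x, monom E J a x ∂r = ∫ x in stratum E, monom E J a x ∂r +
          ∑ F ∈ Finset.univ.erase E, ∫ x in stratum F, monom E J a x ∂r := by
      intro r _ hr
      have hn : Integrable (fun x => ‖x‖) r :=
        Integrable.of_bound (by fun_prop) 1 (by filter_upwards [hr] with x hx; simp [hx])
      rw [Finset.add_sum_erase _ (fun F => ∫ x in stratum F, monom E J a x ∂r)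
        (Finset.mem_univ E), ← integral_iUnion_fintype measurableSet_stratum
        pairwise_disjoint_stratum fun F => (integrable_monom hn J ha).integrableOn,
        iUnion_stratum, setIntegral_univ]
    have hrest : ∀ F ∈ Finset.univ.erase E,
        ∫ x in stratum F, monom E J a x ∂p = ∫ x in stratum F, monom E J a x ∂q := by
      intro F hF
      by_cases hEF : E ⊆ F
      · rw [ih Fᶜ.card ?_ F rfl]
        rw [← hk]
        exact Finset.card_lt_card (Finset.compl_ssubset_compl.2
          (hEF.ssubset_of_ne (Finset.ne_of_mem_erase hF).symm))
      · obtain ⟨k, hkE, hkF⟩ := Finset.not_subset.1 hEF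
        have h0 : ∀ x ∈ stratum F, monom E J a x = 0 := fun x hx =>
          monom_eq_zero J ha hkE (not_not.1 (mt (hx k).1 hkF))
        rw [setIntegral_eq_zero_of_forall_eq_zero h0, setIntegral_eq_zero_of_forall_eq_zero h0]
    have := h E J hJ a ha
    rw [hsum p inferInstance hp, hsum q inferInstance hq, Finset.sum_congr rfl hrest] at this
    exact add_right_cancel this

/-- A signed measure on the sphere is determined by its Mellin transforms. -/
lemma eq_zero_of_mellinVanishes {μ : SMeas n} (hμ : ConcentratedOn μ (unitSphere n))
    (h : ∀ E J : Finset (Fin n), J ⊆ E → MellinVanishes μ E J) : μ = 0 := by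
  have hpq : pos μ = neg μ := by
    have hr := restrict_stratum_eq (ae_mono (pos_le μ) hμ.ae_norm)
      (ae_mono (neg_le μ) hμ.ae_norm) fun E J hJ a ha => by
        have := h E J hJ a ha
        rwa [mellin_eq_sub hμ.boundedSupp ha, sub_eq_zero] at this
    rw [← Measure.restrict_univ (μ := pos μ), ← Measure.restrict_univ (μ := neg μ),
      ← iUnion_stratum, Measure.restrict_iUnion pairwise_disjoint_stratum measurableSet_stratum,
      Measure.restrict_iUnion pairwise_disjoint_stratum measurableSet_stratum]
    simp_rw [hr]
  rw [← pos_sub_neg μ]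
  simp_rw [hpq]
  exact sub_self _

/-- The spherical product vanishes if and only if, for each pair of index sets, one of the factors
has vanishing Mellin transform. -/
lemma sphConv_eq_zero_iff {μ ν : SMeas n} (hμ : BoundedSupp μ) (hν : BoundedSupp ν) :
    sphConv μ ν = 0 ↔ ∀ E J : Finset (Fin n), J ⊆ E →
      MellinVanishes μ E J ∨ MellinVanishes ν E J := by
  constructor
  · intro h E J _
    refine mellinVanishes_or hμ hν fun a ha => ?_
    rw [← mellin_sphConv hμ hν ha, h, mellin_zero]
  · intro h
    refine eq_zero_of_mellinVanishes (sphConv_concentratedOn hμ hν) fun E J hJ a ha => ?_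
    rw [mellin_sphConv hμ hν ha]
    rcases h E J hJ with h | h <;> simp [h a ha]

/-! ### Discrete product measures -/

/-- The discrete product measure with weight `w k t` at the point `t ∈ T k` in direction `k`. -/
def discreteProd (T : Fin n → Finset ℝ) (w : Fin n → ℝ → ℝ) : SMeas n :=
  ∑ s ∈ Fintype.piFinset T, (∏ k, w k (s k)) • VectorMeasure.dirac (WithLp.toLp 2 s) (1 : ℝ)

lemma boundedSupp_discreteProd (T : Fin n → Finset ℝ) (w : Fin n → ℝ → ℝ) :
    BoundedSupp (discreteProd T w) :=
  boundedSupp_sum _ _ fun _ _ => (boundedSupp_dirac _ _).smul _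

lemma discreteProd_ae {T : Fin n → Finset ℝ} (w : Fin n → ℝ → ℝ) {P : Euc n → Prop}
    (h : ∀ s ∈ Fintype.piFinset T, P (WithLp.toLp 2 s)) :
    ∀ᵐ x ∂(discreteProd T w).variation, P x := by
  refine Finset.sum_induction _ (fun μ : SMeas n => ∀ᵐ x ∂μ.variation, P x) ?_ ?_ ?_
  · exact fun μ ν hμ hν => ae_mono VectorMeasure.variation_add_le (ae_add_measure_iff.2 ⟨hμ, hν⟩)
  · simp
  · intro s hs
    rw [VectorMeasure.variation_smul, VectorMeasure.variation_dirac]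
    refine Measure.ae_smul_measure (Measure.ae_smul_measure ?_ _) _
    rw [ae_dirac_eq]
    exact h s hs

lemma mellin_discreteProd (T : Fin n → Finset ℝ) (w : Fin n → ℝ → ℝ) {E : Finset (Fin n)}
    (J : Finset (Fin n)) {a : Fin n → ℂ} (ha : Admissible E a) :
    mellin (discreteProd T w) E J a =
      ∏ k, ∑ t ∈ T k, (w k t : ℂ) * if k ∈ E then signPow (k ∈ J) (a k) t else 1 := by
  rw [discreteProd, mellin_sum _ _ (fun _ _ => (boundedSupp_dirac _ _).smul _) ha,
    Finset.prod_univ_sum]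
  refine Finset.sum_congr rfl fun s _ => ?_
  rw [mellin_smul, mellin_dirac, Complex.ofReal_one, one_mul, Finset.prod_mul_distrib,
    Complex.ofReal_prod, Finset.prod_ite_mem, Finset.univ_inter, monom]

lemma signDelta_eq (E J : Finset (Fin n)) :
    signDelta E J = ((2 : ℝ) ^ E.card)⁻¹ •
      discreteProd (fun k => if k ∈ E then {-1, 1} else {0})
        fun k t => if k ∈ J then Real.sign t else 1 := by
  rw [signDelta, discreteProd, signVectors]
  simp only [Finset.prod_ite_mem, Finset.univ_inter]

lemma boundedSupp_signDelta (E J : Finset (Fin n)) : BoundedSupp (signDelta E J) := by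
  rw [signDelta_eq]
  exact (boundedSupp_discreteProd _ _).smul _

lemma signPow_neg_one (j : Prop) [Decidable j] (a : ℂ) :
    signPow j a (-1) = if j then -1 else 1 := by
  rw [signPow_neg, signPow_of_pos _ _ one_pos]
  simp

lemma signPow_one (j : Prop) [Decidable j] (a : ℂ) : signPow j a 1 = 1 := by
  rw [signPow_of_pos _ _ one_pos]
  simp

/-- The transform factorises over coordinates. In `E`, summing over `±1` gives zero unless the sign
twists of `J` and `K` agree; outside `E`, the atom at 0 annihilates every coordinate that occurs in
the monomial. -/
lemma mellin_signDelta_ne_zero_iff {E J F K : Finset (Fin n)} (hJ : J ⊆ E) (hK : K ⊆ F)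
    {a : Fin n → ℂ} (ha : Admissible F a) :
    mellin (signDelta E J) F K a ≠ 0 ↔ F ⊆ E ∧ K = J := by
  rw [signDelta_eq, mellin_smul, mellin_discreteProd _ _ _ ha]
  have hfac : ∀ k : Fin n, (∑ t ∈ (if k ∈ E then {-1, 1} else {0} : Finset ℝ),
      ((if k ∈ J then Real.sign t else 1 : ℝ) : ℂ) *
        if k ∈ F then signPow (k ∈ K) (a k) t else 1) ≠ 0 ↔
      (k ∈ F → k ∈ E) ∧ (k ∈ K ↔ k ∈ J) := by
    intro k
    have hJE := @hJ k
    have hKF := @hK k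
    by_cases hkE : k ∈ E
    · rw [if_pos hkE, Finset.sum_pair (by norm_num)]
      by_cases hkF : k ∈ F <;> by_cases hkJ : k ∈ J <;> by_cases hkK : k ∈ K <;>
        simp_all [signPow_neg_one, signPow_one, Real.sign_neg]
    · have hkJ : k ∉ J := fun h => hkE (hJE h)
      rw [if_neg hkE, Finset.sum_singleton]
      by_cases hkF : k ∈ F
      · simp [hkJ, hkF, hkE, signPow_zero _ (ha.ne_zero hkF)]
      · have hkK : k ∉ K := fun h => hkF (hKF h)
        simp [hkJ, hkF, hkK]
  have h2 : (((2 : ℝ) ^ E.card)⁻¹ : ℝ) ≠ 0 := by positivity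
  rw [mul_ne_zero_iff, Finset.prod_ne_zero_iff]
  simp only [Complex.ofReal_ne_zero, Finset.mem_univ, true_imp_iff, hfac, forall_and]
  rw [Finset.ext_iff]
  exact ⟨fun h => h.2, fun h => ⟨h2, h⟩⟩

lemma mellinVanishes_signDelta {E J F K : Finset (Fin n)} (hJ : J ⊆ E) (hK : K ⊆ F)
    (h : ¬(F ⊆ E ∧ K = J)) : MellinVanishes (signDelta E J) F K := fun a ha => by
  by_contra h0
  exact h ((mellin_signDelta_ne_zero_iff hJ hK ha).1 h0)

lemma not_mellinVanishes_signDelta {E J F : Finset (Fin n)} (hJ : J ⊆ E) (hJF : J ⊆ F)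
    (hFE : F ⊆ E) (hF : F.Nonempty) : ¬MellinVanishes (signDelta E J) F J := fun h =>
  (mellin_signDelta_ne_zero_iff hJ hJF (admissible_const hF)).2 ⟨hFE, rfl⟩
    (h _ (admissible_const hF))

/-! ### Measures with a single non-vanishing Mellin transform -/

lemma radial_mem_sphStratum {E : Finset (Fin n)} {x : Euc n} (hx : x ∈ stratum E) (h0 : x ≠ 0) :
    radial x ∈ sphStratum E := by
  refine ⟨fun k => ?_, mem_sphere_zero_iff_norm.2 (norm_radial h0)⟩
  rw [← hx k]
  simp [radial, h0]

/-- The points in direction `k` of the measure `testMeasure E J`. -/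
def testPoints (E : Finset (Fin n)) (k : Fin n) : Finset ℝ :=
  if k ∈ E then {-2, -1, 1, 2} else {0}

/-- The weights in direction `k` of the measure `testMeasure E J`. -/
def testWeight (J : Finset (Fin n)) (k : Fin n) (t : ℝ) : ℝ :=
  (if k ∈ J then Real.sign t else 1) * if |t| = 2 then -1 else 1

/-- A measure on the sphere whose only non-vanishing Mellin transform has index `(E, J)`. -/
def testMeasure (E J : Finset (Fin n)) : SMeas n :=
  radialProj (discreteProd (testPoints E) (testWeight J))

lemma testMeasure_concentratedOn (E J : Finset (Fin n)) :
    ConcentratedOn (testMeasure E J) (sphStratum E) := by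
  refine concentratedOn_of_ae (radialProj_ae (boundedSupp_discreteProd _ _)
    (measurableSet_sphStratum E) ?_)
  refine discreteProd_ae _ fun s hs h0 => radial_mem_sphStratum (fun k => ?_) h0
  have hk := Fintype.mem_piFinset.1 hs k
  simp only [testPoints] at hk
  by_cases h : k ∈ E
  · simp only [h, if_true, Finset.mem_insert, Finset.mem_singleton] at hk
    rcases hk with hk | hk | hk | hk <;> simp [hk, h]
  · simp only [h, if_false, Finset.mem_singleton] at hk
    simp [hk, h]

/-- The opposite weights at absolute values 1 and 2 make the total mass in each direction zero,
which excludes proper subsets `F` of `E`; mismatched signs cancel in pairs. -/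
lemma sum_testWeight {E J F K : Finset (Fin n)} (a : ℂ) {k : Fin n} (hk : k ∈ E) :
    ∑ t ∈ testPoints E k, (testWeight J k t : ℂ) *
        (if k ∈ F then signPow (k ∈ K) a t else 1) =
      if k ∈ F ∧ (k ∈ K ↔ k ∈ J) then 2 * (1 - 2 ^ a) else 0 := by
  have h2 : Real.sign 2 = 1 := Real.sign_of_pos two_pos
  rw [testPoints, if_pos hk, Finset.sum_insert (by norm_num), Finset.sum_insert (by norm_num),
    Finset.sum_pair (by norm_num)]
  by_cases hkF : k ∈ F <;> by_cases hkJ : k ∈ J <;> by_cases hkK : k ∈ K <;>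
    simp [hkF, hkJ, hkK, testWeight, signPow_neg, signPow_one, signPow_of_pos _ _ two_pos,
      Real.sign_neg, h2] <;> ring

lemma two_cpow_ne_one {r : ℝ} (hr : 0 < r) : (2 : ℂ) ^ (r : ℂ) ≠ 1 := by
  intro h
  have h1 : ‖(2 : ℂ) ^ (r : ℂ)‖ = 2 ^ r := by
    simp
  rw [h, norm_one] at h1
  exact (Real.one_lt_rpow one_lt_two hr).ne h1

lemma mellin_testMeasure (E J : Finset (Fin n)) {F : Finset (Fin n)} (K : Finset (Fin n))
    {a : Fin n → ℂ} (ha : Admissible F a) :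
    mellin (testMeasure E J) F K a = ∏ k, ∑ t ∈ testPoints E k,
      (testWeight J k t : ℂ) * if k ∈ F then signPow (k ∈ K) (a k) t else 1 := by
  rw [testMeasure, mellin_radialProj (boundedSupp_discreteProd _ _) ha, mellin_discreteProd _ _ _ ha]

lemma mellinVanishes_of_not_subset {μ : SMeas n} {E F : Finset (Fin n)} (J : Finset (Fin n))
    (hμ : ∀ᵐ x ∂μ.variation, x ∈ stratum E) (hFE : ¬F ⊆ E) : MellinVanishes μ F J := by
  intro a ha
  obtain ⟨k, hkF, hkE⟩ := Finset.not_subset.1 hFE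
  refine mellin_eq_zero ?_
  filter_upwards [hμ] with x hx
  exact monom_eq_zero J ha hkF (not_not.1 (mt (hx k).1 hkE))

lemma ConcentratedOn.ae_stratum {μ : SMeas n} {E : Finset (Fin n)}
    (h : ConcentratedOn μ (sphStratum E)) : ∀ᵐ x ∂μ.variation, x ∈ stratum E := by
  filter_upwards [h.ae (measurableSet_sphStratum E)] with x hx using hx.1

lemma ConcentratedOn.sphere {μ : SMeas n} {E : Finset (Fin n)}
    (h : ConcentratedOn μ (sphStratum E)) : ConcentratedOn μ (unitSphere n) :=
  h.mono Set.inter_subset_right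

lemma mellinVanishes_testMeasure {E J F K : Finset (Fin n)} (hJ : J ⊆ E) (hK : K ⊆ F)
    (h : ¬(F = E ∧ K = J)) : MellinVanishes (testMeasure E J) F K := by
  by_cases hFE : F ⊆ E
  · intro a ha
    rw [mellin_testMeasure E J K ha]
    obtain ⟨k, hk, hk'⟩ : ∃ k ∈ E, ¬(k ∈ F ∧ (k ∈ K ↔ k ∈ J)) := by
      by_contra! hcon
      refine h ⟨hFE.antisymm fun k hk => (hcon k hk).1, Finset.ext fun k => ?_⟩
      exact ⟨fun hk => ((hcon k (hFE (hK hk))).2).1 hk, fun hk => ((hcon k (hJ hk)).2).2 hk⟩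
    exact Finset.prod_eq_zero (Finset.mem_univ k) (by rw [sum_testWeight _ hk, if_neg hk'])
  · exact mellinVanishes_of_not_subset K (testMeasure_concentratedOn E J).ae_stratum hFE

lemma not_mellinVanishes_testMeasure {E J : Finset (Fin n)} (hJ : J ⊆ E) (hE : E.Nonempty) :
    ¬MellinVanishes (testMeasure E J) E J := by
  intro h
  have h0 := h _ (admissible_const hE)
  rw [mellin_testMeasure E J J (admissible_const hE), Finset.prod_eq_zero_iff] at h0
  obtain ⟨k, -, hk⟩ := h0
  by_cases hkE : k ∈ E
  · rw [sum_testWeight _ hkE, if_pos ⟨hkE, Iff.rfl⟩] at hk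
    have hc : (0 : ℝ) < (E.card : ℝ)⁻¹ := inv_pos.2 (by exact_mod_cast hE.card_pos)
    rcases mul_eq_zero.1 hk with hk | hk
    · norm_num at hk
    · exact two_cpow_ne_one hc (sub_eq_zero.1 hk).symm
  · have hkJ : k ∉ J := fun h => hkE (hJ h)
    simp [testPoints, testWeight, hkE, hkJ] at hk

/-! ### Symmetry -/

lemma mellin_reflectMeas {μ : SMeas n} (h : BoundedSupp μ) {E J : Finset (Fin n)} (hJ : J ⊆ E)
    {a : Fin n → ℂ} (ha : Admissible E a) :
    mellin (reflectMeas Finset.univ μ) E J a = (-1) ^ J.card * mellin μ E J a := by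
  rw [reflectMeas, mellin_map h (measurable_reflect _) (C := 1)
    (fun x => by rw [norm_reflect, one_mul]) ha]
  have : ∀ x, monom E J a (reflect Finset.univ x) = ((-1 : ℝ) ^ J.card) • monom E J a x :=
    fun x => by rw [monom_reflect hJ, Complex.real_smul]; push_cast; rfl
  simp_rw [this]
  rw [VectorMeasure.integral_fun_smul, Complex.real_smul, mellin]
  push_cast
  rfl

/-- By symmetry the transform equals its own negative. -/
lemma mellinVanishes_of_odd {μ : SMeas n} (h : BoundedSupp μ)
    (hμ : reflectMeas Finset.univ μ = μ) {E J : Finset (Fin n)} (hJ : J ⊆ E)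
    (hodd : ¬Even J.card) : MellinVanishes μ E J := by
  intro a ha
  have := mellin_reflectMeas h hJ ha
  rw [hμ, (Nat.not_even_iff_odd.1 hodd).neg_one_pow, neg_one_mul] at this
  exact self_eq_neg.1 this

lemma ConcentratedOn.reflectMeas {μ : SMeas n} (h : ConcentratedOn μ (unitSphere n)) :
    ConcentratedOn (reflectMeas Finset.univ μ) (unitSphere n) := by
  refine concentratedOn_of_ae (ae_mono VectorMeasure.variation_map_le <|
    (ae_map_iff (measurable_reflect _).aemeasurable measurableSet_unitSphere).2 ?_)
  filter_upwards [h.ae_norm] with x hx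
  exact mem_sphere_zero_iff_norm.2 (by rw [norm_reflect, hx])

lemma ConcentratedOn.add {μ ν : SMeas n} {A : Set (Euc n)} (hμ : ConcentratedOn μ A)
    (hν : ConcentratedOn ν A) : ConcentratedOn (μ + ν) A := fun B hB hBA => by
  rw [add_apply, hμ B hB hBA, hν B hB hBA, add_zero]

lemma ConcentratedOn.smul {μ : SMeas n} {A : Set (Euc n)} (hμ : ConcentratedOn μ A) (c : ℝ) :
    ConcentratedOn (c • μ) A := fun B hB hBA => by
  rw [smul_apply, hμ B hB hBA, smul_zero]

/-- By uniqueness it suffices to compare transforms: reflection multiplies the only non-vanishing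
one by `(-1) ^ |J| = 1`. -/
lemma reflectMeas_testMeasure {E J : Finset (Fin n)} (hJ : J ⊆ E) (heven : Even J.card) :
    reflectMeas Finset.univ (testMeasure E J) = testMeasure E J := by
  have hs := (testMeasure_concentratedOn E J).sphere
  have hr := hs.reflectMeas
  have key : reflectMeas Finset.univ (testMeasure E J) + (-1 : ℝ) • testMeasure E J = 0 := by
    refine eq_zero_of_mellinVanishes (hr.add (hs.smul _)) fun F K hK a ha => ?_
    rw [mellin_add hr.boundedSupp (hs.boundedSupp.smul _) ha, mellin_smul,
      mellin_reflectMeas hs.boundedSupp hK ha]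
    by_cases h : F = E ∧ K = J
    · rw [h.2, heven.neg_one_pow]
      push_cast
      ring
    · rw [mellinVanishes_testMeasure hJ hK h a ha, mul_zero, mul_zero, add_zero]
  rw [eq_neg_of_add_eq_zero_left key]
  ext s
  simp

lemma testMeasure_ne_zero {E J : Finset (Fin n)} (hJ : J ⊆ E) (hE : E.Nonempty) :
    testMeasure E J ≠ 0 := fun h =>
  not_mellinVanishes_testMeasure hJ hE fun a _ => by rw [h, mellin_zero]

lemma sphConv_testMeasure {ν : SMeas n} (hν : BoundedSupp ν) {E J : Finset (Fin n)} (hJ : J ⊆ E)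
    (h : MellinVanishes ν E J) : sphConv ν (testMeasure E J) = 0 := by
  rw [sphConv_eq_zero_iff hν (testMeasure_concentratedOn E J).sphere.boundedSupp]
  intro F K hK
  by_cases h' : F = E ∧ K = J
  · rw [h'.1, h'.2]
    exact Or.inl h
  · exact Or.inr (mellinVanishes_testMeasure hJ hK h')

/-- Otherwise `testMeasure E J` is a non-zero symmetric measure annihilated by `ν`. -/
lemma not_mellinVanishes_of_sphUniversal {ν : SMeas n} (hν : BoundedSupp ν)
    {A : Set (Euc n)} {E J : Finset (Fin n)} (hA : sphStratum E ⊆ A)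
    (h : SphUniversal ν (symMeas A)) (hJ : J ⊆ E) (hE : E.Nonempty)
    (heven : Even J.card) : ¬MellinVanishes ν E J := fun hv =>
  testMeasure_ne_zero hJ hE <| h _ ⟨(testMeasure_concentratedOn E J).mono hA,
    reflectMeas_testMeasure hJ heven⟩ (sphConv_testMeasure hν hJ hv)

/-! ### Universality on symmetric measures -/

lemma mellinVanishes_empty (μ : SMeas n) (J : Finset (Fin n)) : MellinVanishes μ ∅ J :=
  fun _ ha => absurd ha.nonempty Finset.not_nonempty_empty

lemma sphUniversal_sphere_iff {ν : SMeas n} (hν : ConcentratedOn ν (unitSphere n)) :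
    SphUniversal ν (symMeas (unitSphere n)) ↔
      ∀ E J : Finset (Fin n), J ⊆ E → E.Nonempty → Even J.card → ¬MellinVanishes ν E J := by
  constructor
  · exact fun h E J hJ hE heven =>
      not_mellinVanishes_of_sphUniversal hν.boundedSupp Set.inter_subset_right h hJ hE heven
  · rintro h μ ⟨hμ, hsym⟩ hzero
    refine eq_zero_of_mellinVanishes hμ fun E J hJ => ?_
    rcases E.eq_empty_or_nonempty with rfl | hE
    · exact mellinVanishes_empty μ J
    · by_cases heven : Even J.card
      · exact ((sphConv_eq_zero_iff hν.boundedSupp hμ.boundedSupp).1 hzero E J hJ).resolve_left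
          (h E J hJ hE heven)
      · exact mellinVanishes_of_odd hμ.boundedSupp hsym hJ heven

lemma sphUniversal_univ_iff (hn : 1 ≤ n) {ν : SMeas n} (hν : ConcentratedOn ν (unitSphere n)) :
    SphUniversal ν (symMeas (sphStratum Finset.univ)) ↔
      ∀ J : Finset (Fin n), Even J.card → ¬MellinVanishes ν Finset.univ J := by
  have hne : (Finset.univ : Finset (Fin n)).Nonempty := ⟨⟨0, hn⟩, Finset.mem_univ _⟩
  constructor
  · exact fun h J heven => not_mellinVanishes_of_sphUniversal hν.boundedSupp subset_rfl h
      (Finset.subset_univ J) hne heven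
  · rintro h μ ⟨hμ, hsym⟩ hzero
    refine eq_zero_of_mellinVanishes hμ.sphere fun E J hJ => ?_
    by_cases heven : Even J.card
    -- No coordinate vanishes almost everywhere with respect to `μ`, so the full index set controls
    -- all smaller ones.
    · refine MellinVanishes.of_subset hμ.sphere.boundedSupp (E := Finset.univ) ?_
        (((sphConv_eq_zero_iff hν.boundedSupp hμ.sphere.boundedSupp).1 hzero _ J
          (Finset.subset_univ J)).resolve_left (h J heven)) hJ (Finset.subset_univ E)
      filter_upwards [hμ.ae_stratum] with x hx k hk using (hx k).2 hk
    · exact mellinVanishes_of_odd hμ.sphere.boundedSupp hsym hJ heven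

/-! ### Spherical products with sign measures -/

/-- The factor `signDelta` leaves the indices `(F, J)` with `J ⊆ F`. For `F ⊆ E` vanishing of the
transform of `κ` is inherited from `E`; for other `F` it is automatic. -/
lemma sphConv_signDelta_eq_zero_iff {κ : SMeas n} {E J : Finset (Fin n)}
    (hκ : ConcentratedOn κ (sphStratum E)) (hJ : J ⊆ E) (hE : E.Nonempty) :
    sphConv (signDelta Finset.univ J) κ = 0 ↔ MellinVanishes κ E J := by
  rw [sphConv_eq_zero_iff (boundedSupp_signDelta _ _) hκ.sphere.boundedSupp]
  constructor
  · exact fun h => (h E J hJ).resolve_left (not_mellinVanishes_signDelta (Finset.subset_univ J) hJ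
      (Finset.subset_univ E) hE)
  · intro h F K hK
    by_cases hKJ : K = J
    · subst hKJ
      refine Or.inr ?_
      by_cases hFE : F ⊆ E
      · refine MellinVanishes.of_subset hκ.sphere.boundedSupp ?_ h hK hFE
        filter_upwards [hκ.ae_stratum] with x hx k hk using (hx k).2 hk
      · exact mellinVanishes_of_not_subset K hκ.ae_stratum hFE
    · exact Or.inl (mellinVanishes_signDelta (Finset.subset_univ J) hK fun h => hKJ h.2)

lemma component_concentratedOn {μ : SMeas n} (h : ConcentratedOn μ (unitSphere n))
    (E : Finset (Fin n)) : ConcentratedOn (component E μ) (sphStratum E) := by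
  refine concentratedOn_of_ae ?_
  rw [component, VectorMeasure.variation_restrict (measurableSet_stratum E)]
  filter_upwards [ae_restrict_mem (measurableSet_stratum E),
    ae_restrict_of_ae (h.ae measurableSet_unitSphere)] with x h1 h2 using ⟨h1, h2⟩

/-- The points discarded by the restriction have a zero coordinate in `E`, where the monomial
vanishes. -/
lemma mellin_component {μ : SMeas n} {E : Finset (Fin n)}
    (h : ∀ᵐ x ∂μ.variation, ∀ k ∉ E, x k = 0) (J : Finset (Fin n)) {a : Fin n → ℂ}
    (ha : Admissible E a) : mellin (component E μ) E J a = mellin μ E J a := by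
  refine mellin_restrict (measurableSet_stratum E) ?_
  filter_upwards [h] with x hx hxE
  obtain ⟨k, hk, hk0⟩ : ∃ k ∈ E, x k = 0 := by
    by_contra! hcon
    exact hxE fun k => ⟨fun h0 => by_contra fun hk => h0 (hx k hk), hcon k⟩
  exact monom_eq_zero J ha hk hk0

lemma boundedSupp_map_coordProj {μ : SMeas n} (h : BoundedSupp μ) (E : Finset (Fin n)) :
    BoundedSupp (μ.map (coordProj E)) :=
  h.map (measurable_coordProj E) zero_le_one fun x => by
    rw [one_mul]; exact norm_coordProj_le E x

lemma sphProj_concentratedOn {μ : SMeas n} (h : BoundedSupp μ) (E : Finset (Fin n)) :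
    ConcentratedOn (sphProj E μ) (unitSphere n) :=
  radialProj_concentratedOn (boundedSupp_map_coordProj h E)

lemma sphProj_ae {μ : SMeas n} (h : BoundedSupp μ) (E : Finset (Fin n)) :
    ∀ᵐ x ∂(sphProj E μ).variation, ∀ k ∉ E, x k = 0 := by
  have hm : MeasurableSet {x : Euc n | ∀ k ∉ E, x k = 0} := by
    simp only [Set.ofPred_forall]
    exact .iInter fun k => .iInter fun _ => measurableSet_eq_fun (by fun_prop) measurable_const
  refine radialProj_ae (boundedSupp_map_coordProj h E) hm ?_
  have h1 : ∀ᵐ x ∂(μ.map (coordProj E)).variation, ∀ k ∉ E, x k = 0 :=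
    ae_mono VectorMeasure.variation_map_le <| (ae_map_iff (measurable_coordProj E).aemeasurable
      hm).2 <| .of_forall fun x k hk => by simp [coordProj, hk]
  filter_upwards [h1] with x hx _ k hk
  simp [radial, hx k hk]

lemma mellin_sphProj {μ : SMeas n} (h : BoundedSupp μ) {E F : Finset (Fin n)} (hFE : F ⊆ E)
    (J : Finset (Fin n)) {a : Fin n → ℂ} (ha : Admissible F a) :
    mellin (sphProj E μ) F J a = mellin μ F J a := by
  rw [sphProj, mellin_radialProj (boundedSupp_map_coordProj h E) ha,
    mellin_map h (measurable_coordProj E) (C := 1)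
      (fun x => by rw [one_mul]; exact norm_coordProj_le E x) ha]
  simp_rw [monom_coordProj J a hFE]
  rfl

lemma mellinVanishes_congr {μ ν : SMeas n} {E J : Finset (Fin n)}
    (h : ∀ a, Admissible E a → mellin μ E J a = mellin ν E J a) :
    MellinVanishes μ E J ↔ MellinVanishes ν E J :=
  forall₂_congr fun a ha => by rw [h a ha]

lemma sphConv_signDelta_component_eq_zero_iff (hn : 1 ≤ n) {ν : SMeas n}
    (hν : ConcentratedOn ν (unitSphere n)) (J : Finset (Fin n)) :
    sphConv (signDelta Finset.univ J) (component Finset.univ ν) = 0 ↔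
      MellinVanishes ν Finset.univ J := by
  rw [sphConv_signDelta_eq_zero_iff (component_concentratedOn hν _) (Finset.subset_univ J)
    ⟨⟨0, hn⟩, Finset.mem_univ _⟩]
  exact mellinVanishes_congr fun a ha => mellin_component (.of_forall fun x k hk =>
    absurd (Finset.mem_univ k) hk) J ha

lemma sphConv_signDelta_sphProj_eq_zero_iff {ν : SMeas n}
    (hν : ConcentratedOn ν (unitSphere n)) {E J : Finset (Fin n)} (hJ : J ⊆ E)
    (hE : E.Nonempty) :
    sphConv (signDelta Finset.univ J) (component E (sphProj E ν)) = 0 ↔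
      MellinVanishes ν E J := by
  rw [sphConv_signDelta_eq_zero_iff
    (component_concentratedOn (sphProj_concentratedOn hν.boundedSupp E) E) hJ hE]
  exact mellinVanishes_congr fun a ha => by
    rw [mellin_component (sphProj_ae hν.boundedSupp E) J ha,
      mellin_sphProj hν.boundedSupp subset_rfl J ha]

lemma sphConv_signDelta_self_eq_zero_iff {ν : SMeas n} (hν : BoundedSupp ν)
    {J : Finset (Fin n)} (hJ : J.Nonempty) :
    sphConv (signDelta J J) ν = 0 ↔ MellinVanishes ν J J := by
  rw [sphConv_eq_zero_iff (boundedSupp_signDelta _ _) hν]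
  constructor
  · exact fun h => (h J J subset_rfl).resolve_left
      (not_mellinVanishes_signDelta subset_rfl subset_rfl subset_rfl hJ)
  · intro h F K hK
    -- From `K ⊆ F ⊆ J` and `K = J` it follows that `F = J`, so only one index survives.
    by_cases h' : F ⊆ J ∧ K = J
    · obtain ⟨hF, rfl⟩ := h'
      obtain rfl := hF.antisymm hK
      exact Or.inr h
    · exact Or.inl (mellinVanishes_signDelta subset_rfl hK h')

/-- On the coordinate axis only `({i}, ∅)` and `({i}, {i})` matter, and symmetrisation multiplies
transforms by `(1 + (-1) ^ |K|) / 2`, which kills the second. -/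
lemma symmetrise_sphProj_eq_zero_iff {ν : SMeas n} (hν : BoundedSupp ν) (i : Fin n) :
    symmetrise (sphProj {i} ν) = 0 ↔ MellinVanishes ν {i} ∅ := by
  have hs := sphProj_concentratedOn hν {i}
  have hr := hs.reflectMeas
  have hm : ∀ {F K : Finset (Fin n)}, K ⊆ F → ∀ {a}, Admissible F a →
      mellin (symmetrise (sphProj {i} ν)) F K a =
        (1 + (-1) ^ K.card) / 2 * mellin (sphProj {i} ν) F K a := by
    intro F K hK a ha
    rw [symmetrise, mellin_smul, mellin_add hs.boundedSupp hr.boundedSupp ha,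
      mellin_reflectMeas hs.boundedSupp hK ha]
    push_cast
    ring
  constructor
  · intro h a ha
    have := hm (Finset.empty_subset _) ha
    rw [h, mellin_zero, mellin_sphProj hν subset_rfl _ ha] at this
    simpa using this.symm
  · intro h
    refine eq_zero_of_mellinVanishes ((hs.add hr).smul _) fun F K hK a ha => ?_
    rw [hm hK ha]
    by_cases hF : F ⊆ {i}
    · obtain rfl : F = {i} := (Finset.subset_singleton_iff.1 hF).resolve_left ha.nonempty.ne_empty
      rcases Finset.subset_singleton_iff.1 hK with rfl | rfl
      · rw [mellin_sphProj hν subset_rfl _ ha, h a ha, mul_zero]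
      · simp
    · obtain ⟨k, hkF, hki⟩ := Finset.not_subset.1 hF
      rw [mellin_eq_zero, mul_zero]
      filter_upwards [sphProj_ae hν {i}] with x hx using monom_eq_zero K ha hkF (hx k hki)

lemma OfOrder.ae_ne_zero {ν : SMeas n} (h : OfOrder ν Finset.univ) :
    ∀ᵐ x ∂ν.variation, ∀ k, x k ≠ 0 := by
  have h1 : ∀ F ∈ Finset.univ.erase (Finset.univ : Finset (Fin n)),
      ∀ᵐ x ∂ν.variation, x ∉ stratum F := fun F hF => by
    rw [ae_iff, ← SignedMeasure.totalVariation_eq_variation]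
    simpa using h.2 F (Finset.ne_of_mem_erase hF)
  filter_upwards [(Finset.eventually_all _).2 h1] with x hx k
  have h2 : Finset.univ.filter (fun k => x k ≠ 0) = Finset.univ := by
    by_contra hne
    exact hx _ (Finset.mem_erase.2 ⟨hne, Finset.mem_univ _⟩) (mem_stratum_iff.2 rfl)
  exact (Finset.mem_filter.1 (h2.symm ▸ Finset.mem_univ k : k ∈ Finset.univ.filter _)).2

lemma sphUniversal_sphere_iff_of_ofOrder {ν : SMeas n} (hν : ConcentratedOn ν (unitSphere n))
    (h : OfOrder ν Finset.univ) :
    SphUniversal ν (symMeas (unitSphere n)) ↔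
      (∀ J : Finset (Fin n), J.Nonempty → Even J.card → ¬MellinVanishes ν J J) ∧
        ∀ i : Fin n, ¬MellinVanishes ν {i} ∅ := by
  have hx : ∀ E : Finset (Fin n), ∀ᵐ x ∂ν.variation, ∀ k ∈ E, x k ≠ 0 := fun E => by
    filter_upwards [h.ae_ne_zero] with x hx k _ using hx k
  rw [sphUniversal_sphere_iff hν]
  constructor
  · exact fun h => ⟨fun J hJ heven => h J J subset_rfl hJ heven,
      fun i => h {i} ∅ (Finset.empty_subset _) (Finset.singleton_nonempty i) (by simp)⟩
  -- Vanishing at `(E, J)` descends to the smallest admissible index: `(J, J)`, or `({i}, ∅)` if `J`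
  -- is empty.
  · rintro ⟨h1, h2⟩ E J hJ ⟨i, hi⟩ heven hv
    rcases J.eq_empty_or_nonempty with rfl | hJne
    · exact h2 i (hv.of_subset hν.boundedSupp (hx E) (Finset.empty_subset _)
        (Finset.singleton_subset_iff.2 hi))
    · exact h1 J hJne heven (hv.of_subset hν.boundedSupp (hx E) subset_rfl hJ)

end SphConv

end

theorem mainTheorem8 (n : ℕ) (hn : 1 ≤ n) (ν : SphConv.SMeas n)
    (hν : SphConv.ConcentratedOn ν (SphConv.unitSphere n)) :
    (SphConv.SphUniversal ν (SphConv.symMeas (SphConv.sphStratum Finset.univ)) ↔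
      ∀ J : Finset (Fin n), Even J.card →
        SphConv.sphConv (SphConv.signDelta Finset.univ J)
          (SphConv.component Finset.univ ν) ≠ 0) ∧
    (SphConv.SphUniversal ν (SphConv.symMeas (SphConv.unitSphere n)) ↔
      ∀ E J : Finset (Fin n), J ⊆ E → E.Nonempty → Even J.card →
        SphConv.sphConv (SphConv.signDelta Finset.univ J)
          (SphConv.component E (SphConv.sphProj E ν)) ≠ 0) ∧
    (SphConv.OfOrder ν Finset.univ →
      (SphConv.SphUniversal ν (SphConv.symMeas (SphConv.unitSphere n)) ↔
        (∀ J : Finset (Fin n), J.Nonempty → Even J.card →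
          SphConv.sphConv (SphConv.signDelta J J) ν ≠ 0) ∧
        ∀ i : Fin n, SphConv.symmetrise (SphConv.sphProj {i} ν) ≠ 0)) := by
  refine ⟨?_, ?_, fun hord => ?_⟩
  · rw [SphConv.sphUniversal_univ_iff hn hν]
    exact forall₂_congr fun J _ =>
      not_congr (SphConv.sphConv_signDelta_component_eq_zero_iff hn hν J).symm
  · rw [SphConv.sphUniversal_sphere_iff hν]
    exact forall₅_congr fun E J hJ hE _ =>
      not_congr (SphConv.sphConv_signDelta_sphProj_eq_zero_iff hν hJ hE).symm
  · rw [SphConv.sphUniversal_sphere_iff_of_ofOrder hν hord]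
    exact and_congr
      (forall₃_congr fun J hJ _ => not_congr
        (SphConv.sphConv_signDelta_self_eq_zero_iff hν.boundedSupp hJ).symm)
      (forall_congr' fun i => not_congr
        (SphConv.symmetrise_sphProj_eq_zero_iff hν.boundedSupp i).symm)
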